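/- Let $\mathfrak{E}_c=\{(x_i)_{i\in\omega}\in\ell^2 : x_i\in\{0\}\cup\{1/n:n=1,2,\dots\}\text{ for all } i\}$ be complete Erdős space, with the norm topology of $\ell^2$. Let $\mathfrak{E}_c^+=\mathfrak{E}_c\cup\{p\}$, $p\notin\mathfrak{E}_c$, be the space in which $\mathfrak{E}_c$ is an open subspace and the open neighbourhoods of $p$ are the complements of the closed bounded subsets of $\mathfrak{E}_c$. Let $N=\{0\}\cup\{1/n:n=1,2,\dots\}\subset\mathbb{R}$, and let $$P=\bigl(\mathfrak{E}_c\times\{1/n:n=1,2,\dots\}\bigr)\cup\{(p,0)\}$$ have the subspace topology from $\mathfrak{E}_c^+\times N$. A space is zero-dimensional if its clopen sets form a base. A space $(X,\mathcal{T})$ is almost zero-dimensional if there is a zero-dimensional topology $\mathcal{W}$ on $X$, coarser than $\mathcal{T}$, such that every point of $X$ has a base of $\mathcal{T}$-neighbourhoods that are closed in $\mathcal{W}$. Write $\mathcal{K}(X)$ for the space of nonempty compact subsets of $X$ with the Vietoris topology, and $\dim$ for the small inductive dimension (which agrees with the other standard dimension functions on separable metrizable spaces). **Theorem.** The space $P$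 is separable and metrizable; it is totally disconnected, both in the sense that its connected components are single points and in the sense that any two distinct points are separated by a clopen set; it is not almost zero-dimensional; and $$\dim(P)=\dim(\mathcal{K}(P))=1 .$$ In particular, there exists a totally disconnected separable metrizable space $X$ that is not almost zero-dimensional and satisfies $\dim(X)=\dim(\mathcal{K}(X))=1$. -/

import Mathlib

open Set Topology TopologicalSpace

/-- A topological space is zero-dimensional if its clopen sets form a base. -/
def IsZeroDimensional (X : Type*) [TopologicalSpace X] : Prop :=
  IsTopologicalBasis {s : Set X | IsClopen s}

/-- `(X, T)` is almost zero-dimensional: there is a zero-dimensional topology `W` on `X`, coarser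
than `T`, such that every point has a `T`-neighbourhood base consisting of `W`-closed sets.
(In Mathlib `T ≤ W` says that every `W`-open set is `T`-open.) -/
def IsAlmostZeroDimensional (X : Type*) [T : TopologicalSpace X] : Prop :=
  ∃ W : TopologicalSpace X, T ≤ W ∧ @IsZeroDimensional X W ∧
    ∀ x : X, ∀ U ∈ @nhds X T x, ∃ V ∈ @nhds X T x, V ⊆ U ∧ IsClosed[W] V

/-- Complete Erdős space: the points of the Hilbert space `ℓ²` all of whose coordinates lie in
`{0} ∪ {1/n : n = 1, 2, …}`, with the norm topology. -/
def completeErdos : Set (lp (fun _ : ℕ => ℝ) 2) :=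
  {x | ∀ i : ℕ, x i = 0 ∨ ∃ n : ℕ, 0 < n ∧ x i = 1 / (n : ℝ)}

/-- Complete Erdős space together with one more point `p`. -/
inductive CompleteErdosPlus : Type
  | ofErdos (x : completeErdos) : CompleteErdosPlus
  | p : CompleteErdosPlus

namespace CompleteErdosPlus

/-- Complete Erdős space is an open subspace, and the open neighbourhoods of the additional point
`p` are the complements of the closed bounded subsets of complete Erdős space. -/
instance : TopologicalSpace CompleteErdosPlus where
  IsOpen U := IsOpen (ofErdos ⁻¹' U) ∧ (p ∈ U → Bornology.IsBounded (ofErdos ⁻¹' U)ᶜ)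
  isOpen_univ := by simp
  isOpen_inter := by
    rintro U V ⟨hU, hU'⟩ ⟨hV, hV'⟩
    refine ⟨hU.inter hV, fun h => ?_⟩
    rw [preimage_inter, compl_inter]
    exact (hU' h.1).union (hV' h.2)
  isOpen_sUnion := by
    intro S hS
    refine ⟨?_, ?_⟩
    · rw [preimage_sUnion]
      exact isOpen_biUnion fun U hU => (hS U hU).1
    · rintro ⟨U, hU, hp⟩
      exact ((hS U hU).2 hp).subset
        (compl_subset_compl.2 (preimage_mono (subset_sUnion_of_mem hU)))

end CompleteErdosPlus

/-- The convergent sequence `N = {0} ∪ {1/n : n = 1, 2, …}` as a subset of the real line. -/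
def convSeq : Set ℝ :=
  {0} ∪ {t | ∃ n : ℕ, 0 < n ∧ t = 1 / (n : ℝ)}

/-- The space `P = (𝔈_c × {1/n : n = 1, 2, …}) ∪ {(p, 0)}`, as a subset of the product of
`CompleteErdosPlus` and `convSeq`; as a type it carries the subspace topology. -/
def spaceP : Set (CompleteErdosPlus × convSeq) :=
  {z | (∃ x : completeErdos, z.1 = CompleteErdosPlus.ofErdos x) ∧
        ∃ n : ℕ, 0 < n ∧ (z.2 : ℝ) = 1 / (n : ℝ)} ∪
  {z | z.1 = CompleteErdosPlus.p ∧ (z.2 : ℝ) = 0}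

/-!
The space `spaceP` consists of closed-and-open slices, each a copy of complete Erdős space `E`, and
one more point, the apex `(p, 0)`, which is approached by points whose norm and slice index both
tend to infinity.

*Lower bounds.* A nonempty clopen subset of `E` is unbounded
(`completeErdos.exists_lt_norm_of_isClopen`): if bounded, it would contain a coordinatewise maximal
point, but in an open set some coordinate can always be raised. So no bounded neighbourhood of a
point of `E` contains a clopen one, and neither `spaceP` nor its hyperspace is zero-dimensional. If
`spaceP` were almost zero-dimensional, some neighbourhood `V` of the apex, missing the origins of
the slices, would be an intersection of clopen sets. In a slice of large index `V` contains all
points of large norm, so a clopen set containing the origin and missing `V` would be bounded there.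

*Upper bounds.* As `spaceP` embeds in its hyperspace by `z ↦ {z}`, it suffices to bound the
dimension of the latter. Let `Z` be the compact zero-dimensional space of all sequences with values
in `convSeq`. The topology of `E` is generated by the coordinates `E → Z` and the norm, which is
lower semicontinuous for coordinatewise convergence. Hence the topology of the sequences of compact
subsets of `E` is generated by their images in `Z` and a single real function `Ψ`
(`exists_isInducing_seq_compacts`): a weighted sum of countably many lower semicontinuous maxima,
which converges only if every summand does. So such sequences live in the product of a
zero-dimensional space and the line, and those with `Ψ` rational, respectively irrational, form a
zero-dimensional space.

A compact subset of `spaceP` is a sequence of compact subsets of `E`, with norms tending to infinity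
along the sequence, plus the information whether it contains the apex. Its Vietoris topology refines
the topology of such sequences by the uniformity of this divergence
(`spaceP.le_nhds_of_tendsto_slices`). By `IsZeroDimensional.of_uniform_tails` this refinement
preserves zero-dimensionality: the conditions on the individual terms can be replaced by clopen
ones, and near a given point all but finitely many of these hold automatically. So the hyperspace is
the union of two zero-dimensional subspaces, and has dimension at most one
(`hasSmallInductiveDimensionLE_one_of_compl`).
-/

open Set Topology TopologicalSpace

/-! ### Zero-dimensional spaces and small inductive dimension -/

theorem isZeroDimensional_iff {X : Type*} [TopologicalSpace X] :
    IsZeroDimensional X ↔ ∀ x : X, ∀ U ∈ 𝓝 x, ∃ C, IsClopen C ∧ x ∈ C ∧ C ⊆ U := by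
  constructor
  · intro h x U hU
    obtain ⟨C, hC, hx, hCU⟩ := h.mem_nhds_iff.1 hU
    exact ⟨C, hC, hx, hCU⟩
  · intro h
    refine isTopologicalBasis_of_isOpen_of_nhds (fun C hC => hC.isOpen) fun x U hx hU => ?_
    obtain ⟨C, hC, hxC, hCU⟩ := h x U (hU.mem_nhds hx)
    exact ⟨C, hC, hxC, hCU⟩

namespace IsZeroDimensional

variable {X Y : Type*} [TopologicalSpace X] [TopologicalSpace Y]

theorem of_isInducing {f : X → Y} (hf : IsInducing f) (hY : IsZeroDimensional Y) :
    IsZeroDimensional X := by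
  refine isZeroDimensional_iff.2 fun x U hU => ?_
  rw [hf.nhds_eq_comap, Filter.mem_comap] at hU
  obtain ⟨V, hV, hVU⟩ := hU
  obtain ⟨C, hC, hx, hCV⟩ := isZeroDimensional_iff.1 hY _ V hV
  exact ⟨f ⁻¹' C, hC.preimage hf.continuous, hx, (preimage_mono hCV).trans hVU⟩

theorem prod (hX : IsZeroDimensional X) (hY : IsZeroDimensional Y) :
    IsZeroDimensional (X × Y) := by
  refine isZeroDimensional_iff.2 fun x U hU => ?_
  rw [nhds_prod_eq] at hU
  obtain ⟨V, hV, W, hW, hVW⟩ := Filter.mem_prod_iff.1 hU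
  obtain ⟨C, hC, hxC, hCV⟩ := isZeroDimensional_iff.1 hX _ V hV
  obtain ⟨D, hD, hxD, hDW⟩ := isZeroDimensional_iff.1 hY _ W hW
  exact ⟨C ×ˢ D, hC.prod hD, ⟨hxC, hxD⟩, (prod_mono hCV hDW).trans hVW⟩

theorem pi {ι : Type*} {X : ι → Type*} [∀ i, TopologicalSpace (X i)]
    (h : ∀ i, IsZeroDimensional (X i)) : IsZeroDimensional (∀ i, X i) := by
  refine (isTopologicalBasis_pi h).of_isOpen_of_subset (fun C hC => hC.isOpen) ?_
  rintro _ ⟨U, F, hU, rfl⟩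
  have : (F : Set ι).pi U = ⋂ i ∈ F, (fun x : ∀ i, X i => x i) ⁻¹' U i := by
    ext x; simp [Set.mem_pi]
  rw [mem_ofPred_eq, this]
  exact isClopen_biInter_finset fun i hi => IsClopen.preimage (hU i hi) (continuous_apply i)

/-- The clopen sets `{K | K ⊆ ⋃ Cᵢ, K ∩ Cᵢ ≠ ∅}` with clopen `Cᵢ` form a base of the hyperspace. -/
theorem compacts (h : IsZeroDimensional X) : IsZeroDimensional (Compacts X) := by
  refine (IsTopologicalBasis.compacts h).of_isOpen_of_subset (fun C hC => hC.isOpen) ?_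
  rintro _ ⟨u, ⟨hu, huC⟩, rfl⟩
  have hU : IsClopen (⋃₀ u) := by
    rw [sUnion_eq_biUnion]
    exact hu.isClopen_biUnion huC
  have : {K : Compacts X | ↑K ⊆ ⋃₀ u ∧ ∀ U ∈ u, ((K : Set X) ∩ U).Nonempty} =
      {K : Compacts X | ↑K ⊆ ⋃₀ u} ∩ ⋂ U ∈ u, {K : Compacts X | ((K : Set X) ∩ U).Nonempty} := by
    ext K; simp
  change IsClopen {K : Compacts X | ↑K ⊆ ⋃₀ u ∧ ∀ U ∈ u, ((K : Set X) ∩ U).Nonempty}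
  rw [this]
  refine IsClopen.inter ⟨Compacts.isClosed_subsets_of_isClosed hU.1,
    Compacts.isOpen_subsets_of_isOpen hU.2⟩ (hu.isClopen_biInter fun U hU => ?_)
  exact ⟨Compacts.isClosed_inter_nonempty_of_isClosed (huC hU).1,
    Compacts.isOpen_inter_nonempty_of_isOpen (huC hU).2⟩

/-- In a second countable zero-dimensional space, disjoint closed sets are separated by a clopen
set: the space is a countable union of clopen sets each missing one of the two, and these can be
made disjoint. -/
theorem exists_isClopen_between [SecondCountableTopology X] (hX : IsZeroDimensional X)
    {A B : Set X} (hA : IsClosed A) (hB : IsClosed B) (hAB : Disjoint A B) :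
    ∃ C, IsClopen C ∧ A ⊆ C ∧ Disjoint C B := by
  have key : ∀ x : X, ∃ C, IsClopen C ∧ x ∈ C ∧ (Disjoint C A ∨ Disjoint C B) := by
    intro x
    by_cases hx : x ∈ A
    · obtain ⟨C, hC, hxC, hCB⟩ := isZeroDimensional_iff.1 hX x Bᶜ
        (hB.isOpen_compl.mem_nhds fun h => hAB.notMem_of_mem_left hx h)
      exact ⟨C, hC, hxC, Or.inr (disjoint_left.2 hCB)⟩
    · obtain ⟨C, hC, hxC, hCA⟩ := isZeroDimensional_iff.1 hX x Aᶜ (hA.isOpen_compl.mem_nhds hx)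
      exact ⟨C, hC, hxC, Or.inl (disjoint_left.2 hCA)⟩
  choose c hc hxc hcAB using key
  obtain ⟨s, hs, hsu⟩ := TopologicalSpace.countable_cover_nhds fun x =>
    (hc x).isOpen.mem_nhds (hxc x)
  rcases s.eq_empty_or_nonempty with rfl | hne
  · have : ∀ x : X, False := fun x => by simpa using hsu.symm.subset (mem_univ x)
    exact ⟨∅, isClopen_empty, fun x => (this x).elim, disjoint_left.2 fun x => (this x).elim⟩
  obtain ⟨e, rfl⟩ := hs.exists_eq_range hne
  set D := disjointed fun n => c (e n) with hD
  have hDc : ∀ n, IsClopen (D n) := fun n =>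
    disjointedRec (p := IsClopen) (fun _ i ht => ht.diff (hc (e i))) (hc (e n))
  have hDu : ∀ x, ∃ n, x ∈ D n := fun x => by
    have : x ∈ ⋃ n, D n := by
      rw [hD, iUnion_disjointed]
      simpa using hsu.symm.subset (mem_univ x)
    simpa using this
  have hDd : ∀ {m n x}, x ∈ D m → x ∈ D n → m = n := fun {m n x} hm hn => by
    by_contra h
    exact (disjoint_disjointed (fun n => c (e n)) h).notMem_of_mem_left hm hn
  have hDle : ∀ n, D n ⊆ c (e n) := fun n => disjointed_le _ n
  refine ⟨⋃ n ∈ {n | Disjoint (c (e n)) B}, D n,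
    ⟨⟨?_⟩, isOpen_biUnion fun n _ => (hDc n).isOpen⟩, ?_, ?_⟩
  · have : (⋃ n ∈ {n | Disjoint (c (e n)) B}, D n)ᶜ =
        ⋃ n ∈ {n | ¬ Disjoint (c (e n)) B}, D n := by
      ext x
      obtain ⟨n, hn⟩ := hDu x
      simp only [mem_compl_iff, mem_iUnion, mem_ofPred_eq, exists_prop, not_exists, not_and]
      constructor
      · exact fun h => ⟨n, fun h' => h n h' hn, hn⟩
      · rintro ⟨m, hm, hxm⟩ k hk hxk
        exact hm (hDd hxk hxm ▸ hk)
    rw [this]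
    exact isOpen_biUnion fun n _ => (hDc n).isOpen
  · intro x hx
    obtain ⟨n, hn⟩ := hDu x
    refine mem_biUnion (x := n) ?_ hn
    exact (hcAB (e n)).resolve_left fun h => h.notMem_of_mem_left (hDle n hn) hx
  · rw [disjoint_iUnion₂_left]
    exact fun n hn => Disjoint.mono_left (hDle n) hn

end IsZeroDimensional

/-- A set of reals with dense complement is zero-dimensional: intervals with end points in the
complement are relatively clopen. -/
theorem isZeroDimensional_of_dense_compl {A : Set ℝ} (hA : Dense Aᶜ) : IsZeroDimensional A := by
  refine isZeroDimensional_iff.2 fun x U hU => ?_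
  obtain ⟨V, hV, hVU⟩ := mem_nhds_subtype _ _ _ |>.1 hU
  obtain ⟨l, u, hx, hlu⟩ := mem_nhds_iff_exists_Ioo_subset.1 hV
  obtain ⟨a, ha, hla, hax⟩ := hA.exists_between hx.1
  obtain ⟨b, hb, hxb, hbu⟩ := hA.exists_between hx.2
  refine ⟨Subtype.val ⁻¹' Ioo a b, ⟨?_, isOpen_Ioo.preimage continuous_subtype_val⟩, ⟨hax, hxb⟩,
    fun y hy => hVU (hlu ⟨hla.trans hy.1, hy.2.trans hbu⟩)⟩
  have : (Subtype.val ⁻¹' Ioo a b : Set A) = Subtype.val ⁻¹' Icc a b := by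
    ext y
    have h1 : (y : ℝ) ≠ a := fun h => ha (h ▸ y.2)
    have h2 : (y : ℝ) ≠ b := fun h => hb (h ▸ y.2)
    simp only [mem_preimage, mem_Ioo, mem_Icc]
    exact ⟨fun h => ⟨h.1.le, h.2.le⟩, fun h => ⟨h.1.lt_of_ne h1.symm, h.2.lt_of_ne h2⟩⟩
  rw [this]
  exact isClosed_Icc.preimage continuous_subtype_val

/-- The small inductive dimension is monotone under passing to subspaces. -/
theorem hasSmallInductiveDimensionLT_of_isInducing {n : ℕ} {X Y : Type*}
    [TopologicalSpace X] [TopologicalSpace Y] {f : X → Y} (hf : IsInducing f)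
    (hY : HasSmallInductiveDimensionLT Y n) : HasSmallInductiveDimensionLT X n := by
  induction n generalizing X Y with
  | zero =>
    rw [hasSmallInductiveDimensionLT_zero_iff] at hY ⊢
    exact Function.isEmpty f
  | succ n ih =>
    obtain _ | ⟨_, s, hs, h⟩ := hY
    refine .succ n _ (hs.isInducing hf) ?_
    rintro _ ⟨U, hU, rfl⟩
    have hmaps : MapsTo f (frontier (f ⁻¹' U)) (frontier U) :=
      fun x hx => hf.continuous.frontier_preimage_subset U hx
    refine ih (f := hmaps.restrict) ?_ (h U hU)
    exact .of_comp (hf.continuous.restrict hmaps) continuous_subtype_val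
      (hf.comp IsInducing.subtypeVal)

/-- A regular second countable space that is the union of two zero-dimensional subspaces has small
inductive dimension at most one: around each point there are arbitrarily small open sets whose
frontier misses one of the two subspaces. -/
theorem hasSmallInductiveDimensionLE_one_of_compl {X : Type*} [TopologicalSpace X]
    [RegularSpace X] [SecondCountableTopology X] {S : Set X} (hS : IsZeroDimensional S)
    (hS' : IsZeroDimensional (Sᶜ : Set X)) : HasSmallInductiveDimensionLE X 1 := by
  refine .succ 1 {U | IsOpen U ∧ frontier U ⊆ Sᶜ} ?_ ?_
  · refine isTopologicalBasis_of_isOpen_of_nhds (fun U hU => hU.1) fun x O hx hO => ?_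
    -- Closed neighbourhoods of `x` with `L ⊆ interior N`, `N ⊆ interior M`, `M ⊆ O`.
    obtain ⟨M, hM, hMc, hMO⟩ := exists_mem_nhds_isClosed_subset (hO.mem_nhds hx)
    obtain ⟨N, hN, hNc, hNM⟩ := exists_mem_nhds_isClosed_subset (interior_mem_nhds.2 hM)
    obtain ⟨L, hL, hLc, hLN⟩ := exists_mem_nhds_isClosed_subset (interior_mem_nhds.2 hN)
    obtain ⟨C, hC, hNC, hCM⟩ := hS.exists_isClopen_between
      (A := Subtype.val ⁻¹' N) (B := Subtype.val ⁻¹' (interior M)ᶜ)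
      (hNc.preimage continuous_subtype_val)
      (isOpen_interior.isClosed_compl.preimage continuous_subtype_val)
      (disjoint_left.2 fun y hy hy' => hy' (hNM hy))
    set A : Set X := Subtype.val '' C with hAdef
    set B : Set X := Subtype.val '' Cᶜ with hBdef
    have hAM : A ⊆ M := by
      rintro _ ⟨y, hy, rfl⟩
      by_contra h
      exact disjoint_left.1 hCM hy fun h' => h (interior_subset h')
    have hAB : Disjoint (closure A) B := by
      rw [disjoint_left]
      rintro _ hz ⟨y, hy, rfl⟩
      have : y ∈ closure C := by rwa [closure_subtype]
      exact hy (hC.isClosed.closure_eq ▸ this)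
    have hBA : Disjoint A (closure B) := by
      rw [disjoint_left]
      rintro _ ⟨y, hy, rfl⟩ hz
      have : y ∈ closure Cᶜ := by rwa [closure_subtype]
      exact hC.compl.isClosed.closure_eq.subset this hy
    have hsep := completely_normal (X := X) (s := A ∪ L) (t := B ∪ Oᶜ) ?_ ?_
    · obtain ⟨U, V, hU, hV, hAU, hBV, hUV⟩ := separatedNhds_iff_disjoint.2 hsep
      have hcl : Disjoint (closure U) V := hUV.closure_left hV
      refine ⟨U, ⟨hU, fun z hz hzS => ?_⟩, hAU (Or.inr (mem_of_mem_nhds hL)), fun z hz => ?_⟩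
      · rw [hU.frontier_eq] at hz
        by_cases hzC : (⟨z, hzS⟩ : S) ∈ C
        · exact hz.2 (hAU (Or.inl ⟨_, hzC, rfl⟩))
        · exact disjoint_left.1 hcl hz.1 (hBV (Or.inl ⟨_, hzC, rfl⟩))
      · by_contra h
        exact disjoint_left.1 hUV hz (hBV (Or.inr h))
    · rw [closure_union, hLc.closure_eq, disjoint_union_left, disjoint_union_right,
        disjoint_union_right]
      refine ⟨⟨hAB, ?_⟩, ?_, ?_⟩
      · exact disjoint_left.2 fun z hz hz' => hz' (hMO (closure_minimal hAM hMc hz))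
      · rw [disjoint_left]
        rintro _ hz ⟨y, hy, rfl⟩
        exact hy (hNC (show (y : X) ∈ N from interior_subset (hLN hz)))
      · exact disjoint_left.2 fun z hz hz' =>
          hz' (hMO (interior_subset (hNM (interior_subset (hLN hz)))))
    · rw [closure_union, hO.isClosed_compl.closure_eq, disjoint_union_left, disjoint_union_right,
        disjoint_union_right]
      refine ⟨⟨hBA, ?_⟩, ?_, ?_⟩
      · exact disjoint_left.2 fun z hz hz' => hz' (hMO (hAM hz))
      · refine (Disjoint.closure_right ?_ isOpen_interior).mono_left hLN
        rw [disjoint_left]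
        rintro _ hz ⟨y, hy, rfl⟩
        exact hy (hNC (show (y : X) ∈ N from interior_subset hz))
      · exact disjoint_left.2 fun z hz hz' =>
          hz' (hMO (interior_subset (hNM (interior_subset (hLN hz)))))
  · rintro U ⟨-, hU⟩
    exact hasSmallInductiveDimensionLT_one_iff.2
      (hS'.of_isInducing (IsEmbedding.inclusion hU).isInducing)

/-- Refining a zero-dimensional second countable topology by uniform convergence to infinity along
a sequence does not raise the dimension. Here `g x ∈ O i k` expresses that the `i`-th term at `x`
exceeds `k`; every `x` has terms tending to infinity, and the topology of `X` is generated by `g`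
and by the sets on which the terms with index `≥ N` uniformly exceed `k`. -/
theorem IsZeroDimensional.of_uniform_tails {X Y : Type*} [TopologicalSpace X] [TopologicalSpace Y]
    [SecondCountableTopology Y] (hY : IsZeroDimensional Y) {g : X → Y} (hg : Continuous g)
    {O : ℕ → ℕ → Set Y} (hO : ∀ i k, IsOpen (O i k))
    (hcl : ∀ i k, closure (O i (k + 1)) ⊆ O i k)
    (hU : ∀ N k, IsOpen {x | ∀ i ≥ N, g x ∈ O i k})
    (hev : ∀ x k, ∃ N, ∀ i ≥ N, g x ∈ O i k)
    (hn : ∀ (x : X) (l : Filter X), Filter.Tendsto g l (𝓝 (g x)) →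
      (∀ N k, (∀ i ≥ N, g x ∈ O i k) → ∀ᶠ y in l, ∀ i ≥ N, g y ∈ O i k) → l ≤ 𝓝 x) :
    IsZeroDimensional X := by
  -- Clopen sets `E i k` of `Y` with `closure (O i (k + 1)) ⊆ E i k ⊆ O i k`.
  have hsep : ∀ i k, ∃ E, IsClopen E ∧ closure (O i (k + 1)) ⊆ E ∧ E ⊆ O i k := by
    intro i k
    obtain ⟨E, hE, hE1, hE2⟩ := hY.exists_isClopen_between (isClosed_closure (s := O i (k + 1)))
      (hO i k).isClosed_compl (disjoint_compl_right_iff_subset.2 (hcl i k))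
    exact ⟨E, hE, hE1, disjoint_compl_right_iff_subset.1 hE2⟩
  choose E hE hOE hEO using hsep
  refine isZeroDimensional_iff.2 fun x => ?_
  suffices h : (⨅ C ∈ {C : Set X | IsClopen C ∧ x ∈ C}, Filter.principal C) ≤ 𝓝 x by
    intro U hUx
    have := h hUx
    rw [Filter.mem_biInf_of_directed] at this
    · obtain ⟨C, hC, hCU⟩ := this
      exact ⟨C, hC.1, hC.2, by simpa using hCU⟩
    · rintro C hC D hD
      exact ⟨C ∩ D, ⟨hC.1.inter hD.1, hC.2, hD.2⟩, by simp, by simp⟩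
    · exact ⟨univ, isClopen_univ, mem_univ x⟩
  have hmem : ∀ {C V : Set X}, IsClopen C → x ∈ C → C ⊆ V →
      V ∈ ⨅ C ∈ {C : Set X | IsClopen C ∧ x ∈ C}, Filter.principal C := fun hC hx hCV =>
    Filter.mem_of_superset (Filter.mem_iInf_of_mem _ (Filter.mem_iInf_of_mem ⟨hC, hx⟩
      (Filter.mem_principal_self _))) hCV
  refine hn x _ (fun W hW => ?_) fun N k hx => ?_
  · obtain ⟨C, hC, hxC, hCW⟩ := isZeroDimensional_iff.1 hY _ W hW
    exact hmem (hC.preimage hg) hxC (preimage_mono hCW)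
  · obtain ⟨M, hM⟩ := hev x (k + 1)
    obtain ⟨C, hC, hxC, hCO⟩ := isZeroDimensional_iff.1 hY (g x)
      (⋂ i ∈ Finset.Ico N M, O i k) (((isOpen_biInter_finset fun i _ => hO i k)).mem_nhds (by
        simp only [mem_iInter, Finset.mem_Ico]
        exact fun i hi => hx i hi.1))
    refine hmem (C := g ⁻¹' C ∩ ⋂ i ≥ M, g ⁻¹' E i k) ⟨?_, ?_⟩ ⟨hxC, ?_⟩ ?_
    · exact (hC.1.preimage hg).inter (isClosed_biInter fun i _ => (hE i k).1.preimage hg)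
    · rw [isOpen_iff_mem_nhds]
      rintro y ⟨hyC, hyE⟩
      obtain ⟨L, hL⟩ := hev y (k + 1)
      -- Near `y`, the terms with index `≥ L` exceed `k + 1`; only finitely many remain.
      filter_upwards [(hC.2.preimage hg).mem_nhds hyC, (hU L (k + 1)).mem_nhds hL,
        (isOpen_biInter_finset (s := Finset.Ico M L) (f := fun i => g ⁻¹' E i k)
          fun i _ => (hE i k).2.preimage hg).mem_nhds (by
            simp only [mem_iInter, Finset.mem_Ico] at hyE ⊢
            exact fun i hi => hyE i hi.1)] with z hz1 hz2 hz3
      refine ⟨hz1, ?_⟩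
      simp only [mem_iInter, Finset.mem_Ico] at hz3 ⊢
      intro i hi
      rcases lt_or_ge i L with h | h
      · exact hz3 i ⟨hi, h⟩
      · exact hOE i k (subset_closure (hz2 i h))
    · simp only [mem_iInter]
      exact fun i hi => hOE i k (subset_closure (hM i hi))
    · rintro y ⟨hy1, hy2⟩ i hi
      simp only [mem_iInter] at hy2
      rcases lt_or_ge i M with h | h
      · have := hCO hy1
        simp only [mem_iInter, Finset.mem_Ico] at this
        exact this i ⟨hi, h⟩
      · exact hEO i k (hy2 i h)

/-! ### Hyperspaces of graphs of semicontinuous functions -/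

theorem tendsto_compacts_nhds {X α : Type*} [TopologicalSpace α] {l : Filter X}
    {F : X → Compacts α} {K : Compacts α}
    (hsub : ∀ U, IsOpen U → (K : Set α) ⊆ U → ∀ᶠ x in l, (F x : Set α) ⊆ U)
    (hhit : ∀ U, IsOpen U → ((K : Set α) ∩ U).Nonempty → ∀ᶠ x in l, ((F x : Set α) ∩ U).Nonempty) :
    Filter.Tendsto F l (𝓝 K) := by
  let _ := TopologicalSpace.vietoris α
  rw [Compacts.isEmbedding_coe.isInducing.nhds_eq_comap, Filter.tendsto_comap_iff,
    tendsto_nhds_generateFrom_iff]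
  rintro _ (⟨U, hU, rfl⟩ | ⟨U, hU, rfl⟩) hK
  exacts [hsub U hU hK, hhit U hU hK]

/-- If all terms of a series of nonnegative functions are eventually not much below their limit
values and the sum of the series converges to the sum of these values, then no term is eventually
much above its limit value. -/
theorem eventually_lt_of_tendsto_tsum {X J : Type*} {l : Filter X} {a : J → X → ℝ} {A : J → ℝ}
    (ha : ∀ j x, 0 ≤ a j x) (hsa : ∀ x, Summable fun j => a j x) (hsA : Summable A)
    (hlow : ∀ j c, c < A j → ∀ᶠ x in l, c < a j x)
    (hsum : Filter.Tendsto (fun x => ∑' j, a j x) l (𝓝 (∑' j, A j)))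
    {j : J} {c : ℝ} (hc : A j < c) : ∀ᶠ x in l, a j x < c := by
  classical
  obtain ⟨ε, hε, rfl⟩ : ∃ ε, 0 < ε ∧ c = A j + 3 * ε := ⟨(c - A j) / 3, by linarith, by ring⟩
  obtain ⟨s, hjs, hs⟩ : ∃ s : Finset J, j ∈ s ∧ ∑' j, A j - ε < ∑ i ∈ s, A i :=
    ((Filter.eventually_ge_atTop {j}).and
      (hsA.hasSum.eventually (lt_mem_nhds (sub_lt_self _ hε)))).exists.imp
        fun s hs => ⟨Finset.singleton_subset_iff.1 hs.1, hs.2⟩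
  set δ := ε / ((s.erase j).card + 1) with hδ
  have hδ0 : 0 < δ := by positivity
  have hδs : (s.erase j).card * δ ≤ ε := by
    rw [hδ, mul_div_assoc', div_le_iff₀ (by positivity)]
    nlinarith
  filter_upwards [hsum.eventually (gt_mem_nhds (lt_add_of_pos_right _ hε)),
    (Filter.eventually_all_finset (s.erase j)).2 fun i _ =>
      hlow i (A i - δ) (sub_lt_self _ hδ0)] with x hx1 hx2
  have h1 : ∑ i ∈ s.erase j, (A i - δ) ≤ ∑ i ∈ s.erase j, a i x :=
    Finset.sum_le_sum fun i hi => (hx2 i hi).le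
  have h2 : ∑ i ∈ s, a i x ≤ ∑' i, a i x := (hsa x).sum_le_tsum _ fun i _ => ha i x
  rw [← Finset.add_sum_erase _ _ hjs] at h2 hs
  rw [Finset.sum_sub_distrib, Finset.sum_const, nsmul_eq_mul] at h1
  linarith

/-- The maximum of `0` and of the values of `β` on the part of `K` in `C`, so that
it is `0` if `K` misses `C`. -/
noncomputable def supOn {E : Type*} [TopologicalSpace E] (β : E → ℝ) (C : Set E)
    (K : Compacts E) : ℝ :=
  sSup (insert 0 (β '' (K ∩ C)))

namespace supOn

variable {E : Type*} [TopologicalSpace E] {β : E → ℝ} {C : Set E}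

theorem isCompact_values (hβ : Continuous β) (hC : IsClosed C) (K : Compacts E) :
    IsCompact (insert 0 (β '' (K ∩ C))) :=
  ((K.isCompact.inter_right hC).image hβ).insert 0

theorem lt_iff (hβ : Continuous β) (hC : IsClosed C) (K : Compacts E) {c : ℝ} (hc : 0 ≤ c) :
    c < supOn β C K ↔ ((K : Set E) ∩ {x | x ∈ C ∧ c < β x}).Nonempty := by
  rw [supOn, lt_csSup_iff (isCompact_values hβ hC K).bddAbove (insert_nonempty _ _)]
  constructor
  · rintro ⟨_, rfl | ⟨x, hx, rfl⟩, hb⟩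
    · exact absurd hb hc.not_gt
    · exact ⟨x, hx.1, hx.2, hb⟩
  · rintro ⟨x, hxK, hxC, hx⟩
    exact ⟨β x, Or.inr ⟨x, ⟨hxK, hxC⟩, rfl⟩, hx⟩

theorem lt_const_iff (hβ : Continuous β) (hC : IsClosed C) (K : Compacts E) {c : ℝ} (hc : 0 < c) :
    supOn β C K < c ↔ (K : Set E) ⊆ {x | x ∈ C → β x < c} := by
  constructor
  · intro h x hxK hxC
    exact (le_csSup (isCompact_values hβ hC K).bddAbove (Or.inr ⟨x, ⟨hxK, hxC⟩, rfl⟩)).trans_lt h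
  · intro h
    rcases (isCompact_values hβ hC K).sSup_mem (insert_nonempty _ _) with h0 | ⟨x, hx, hx'⟩
    · rwa [supOn, h0]
    · rw [supOn, ← hx']
      exact h hx.1 hx.2

theorem nonneg (hβ : Continuous β) (hC : IsClosed C) (K : Compacts E) : 0 ≤ supOn β C K :=
  le_csSup (isCompact_values hβ hC K).bddAbove (mem_insert _ _)

theorem le_one (hβ1 : ∀ x, β x ≤ 1) (K : Compacts E) : supOn β C K ≤ 1 := by
  refine csSup_le (insert_nonempty _ _) ?_
  rintro _ (rfl | ⟨x, -, rfl⟩)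
  exacts [zero_le_one, hβ1 x]

theorem continuous (hβ : Continuous β) (hC : IsClopen C) : Continuous (supOn β C) := by
  refine continuous_iff_continuousAt.2 fun K => tendsto_order.2 ⟨fun c hc => ?_, fun c hc => ?_⟩
  · rcases lt_or_ge c 0 with h | h
    · exact Filter.Eventually.of_forall fun K => h.trans_le (nonneg hβ hC.1 K)
    · simp only [lt_iff hβ hC.1 _ h] at hc ⊢
      exact (Compacts.isOpen_inter_nonempty_of_isOpen
        (hC.2.inter (isOpen_lt continuous_const hβ))).mem_nhds hc
  · have h : 0 < c := (nonneg hβ hC.1 K).trans_lt hc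
    simp only [lt_const_iff hβ hC.1 _ h] at hc ⊢
    refine (Compacts.isOpen_subsets_of_isOpen ?_).mem_nhds hc
    have : {x | x ∈ C → β x < c} = Cᶜ ∪ {x | β x < c} := by
      ext x; simp [imp_iff_not_or]
    rw [this]
    exact hC.1.isOpen_compl.union (isOpen_lt hβ continuous_const)

end supOn

section Hyperspace

variable {E Z : Type*} [TopologicalSpace E] [TopologicalSpace Z] [CompactSpace Z] [T2Space Z]
  [TotallyDisconnectedSpace Z] {f : E → Z} {β : E → ℝ}

/-- Given a compact set `K`, each point has neighbourhoods of the form `f ⁻¹' C ∩ {β < c}`, where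
`C` is clopen and `c` exceeds the values of `β` on all of `K ∩ f ⁻¹' C`. -/
theorem exists_clopen_supOn_lt (hind : IsInducing fun x => (f x, β x))
    (hf : Function.Injective f) (hβ0 : ∀ x, 0 ≤ β x)
    (hlsc : ∀ c, ∃ W : Set Z, IsOpen W ∧ {x | c < β x} = f ⁻¹' W)
    (K : Compacts E) {x : E} {U : Set E} (hU : IsOpen U) (hxU : x ∈ U) :
    ∃ (C : Clopens Z) (c : ℝ), f x ∈ C ∧ 0 < c ∧ supOn β (f ⁻¹' C) K < c ∧
      {y | f y ∈ C ∧ β y < c} ⊆ U := by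
  have hfc : Continuous f := continuous_fst.comp hind.continuous
  have hβc : Continuous β := continuous_snd.comp hind.continuous
  have hUx := hU.mem_nhds hxU
  rw [hind.nhds_eq_comap, Filter.mem_comap] at hUx
  obtain ⟨S, hS, hSU⟩ := hUx
  rw [nhds_prod_eq, Filter.mem_prod_iff] at hS
  obtain ⟨V, hV, T, hT, hVT⟩ := hS
  obtain ⟨δ, hδ, hδT⟩ := Metric.mem_nhds_iff.1 hT
  obtain ⟨W, hW, hWβ⟩ := hlsc (β x - δ)
  have hxW : f x ∈ W := hWβ.subset (show β x - δ < β x by linarith)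
  -- The part of `K` on which `β` is large has compact image missing `f x`.
  have hcomp : IsCompact (f '' (K ∩ {y | β x + δ ≤ β y})) :=
    (K.isCompact.inter_right (isClosed_le continuous_const hβc)).image hfc
  have hxc : f x ∉ f '' (K ∩ {y | β x + δ ≤ β y}) := by
    rintro ⟨y, ⟨-, hy⟩, hyx⟩
    rw [hf hyx] at hy
    have : β x + δ ≤ β x := hy
    linarith
  obtain ⟨C, hC, hxC, hCs⟩ := compact_exists_isClopen_in_isOpen
    ((isOpen_interior (s := V)).inter (hW.inter hcomp.isClosed.isOpen_compl))
    ⟨mem_interior_iff_mem_nhds.2 hV, hxW, hxc⟩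
  have hc0 : 0 < β x + δ := by linarith [hβ0 x]
  refine ⟨⟨C, hC⟩, β x + δ, hxC, hc0, ?_, ?_⟩
  · refine (supOn.lt_const_iff hβc (hC.1.preimage hfc) K hc0).2 ?_
    intro y hyK hyC
    by_contra h
    exact (hCs hyC).2.2 ⟨y, ⟨hyK, not_lt.1 h⟩, rfl⟩
  · rintro y ⟨hyC, hy⟩
    refine hSU (hVT ⟨interior_subset (hCs hyC).1, hδT ?_⟩)
    have : β x - δ < β y := hWβ.symm.subset (show y ∈ f ⁻¹' W from (hCs hyC).2.1)
    rw [Metric.mem_ball, Real.dist_eq, abs_lt]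
    constructor <;> linarith

/-- Let `E` carry the topology induced by an injection `f` into a compact zero-dimensional space
and by a function `β` that is lower semicontinuous for the topology induced by `f`. Then the
topology on sequences of compact subsets of `E` is induced by the map to sequences of compact
subsets of `Z` and a single real function, a weighted sum of the maxima of `β` over the pieces
`K n ∩ f ⁻¹' C` with `C` clopen. -/
theorem exists_isInducing_seq_compacts [SecondCountableTopology Z]
    (hind : IsInducing fun x => (f x, β x)) (hfc : Continuous f)
    (hf : Function.Injective f) (hβ0 : ∀ x, 0 ≤ β x) (hβ1 : ∀ x, β x ≤ 1)
    (hlsc : ∀ c, ∃ W : Set Z, IsOpen W ∧ {x | c < β x} = f ⁻¹' W) :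
    ∃ Ψ : (ℕ → Compacts E) → ℝ,
      IsInducing fun K : ℕ → Compacts E => ((fun n => (K n).map f hfc), Ψ K) := by
  have hβc : Continuous β := continuous_snd.comp hind.continuous
  have : Countable (Clopens Z) := Clopens.countable_iff_secondCountable.2 inferInstance
  obtain ⟨w, hw0, s, hws, -⟩ :=
    NNReal.exists_pos_sum_of_countable (ε := 1) one_ne_zero (ℕ × Clopens Z)
  have hw : Summable fun j => (w j : ℝ) := NNReal.summable_coe.2 hws.summable
  have hCl : ∀ C : Clopens Z, IsClopen (f ⁻¹' (C : Set Z)) := fun C => C.isClopen.preimage hfc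
  set a : ℕ × Clopens Z → (ℕ → Compacts E) → ℝ :=
    fun j K => w j * supOn β (f ⁻¹' (j.2 : Set Z)) (K j.1) with ha
  have ha0 : ∀ j K, 0 ≤ a j K := fun j K =>
    mul_nonneg (w j).2 (supOn.nonneg hβc (hCl j.2).1 _)
  have haw : ∀ j K, a j K ≤ w j := fun j K =>
    mul_le_of_le_one_right (w j).2 (supOn.le_one hβ1 _)
  have hsa : ∀ K, Summable fun j => a j K := fun K =>
    hw.of_nonneg_of_le (fun j => ha0 j K) fun j => haw j K
  have hac : ∀ j, Continuous (a j) := fun j =>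
    continuous_const.mul ((supOn.continuous hβc (hCl j.2)).comp (continuous_apply j.1))
  have hΨ : Continuous fun K => ∑' j, a j K := continuous_tsum hac hw fun j K => by
    rw [Real.norm_of_nonneg (ha0 j K)]
    exact haw j K
  refine ⟨fun K => ∑' j, a j K, isInducing_iff_nhds.2 fun K => le_antisymm ?_ ?_⟩
  · refine Filter.map_le_iff_le_comap.1 (Continuous.tendsto (Continuous.prodMk ?_ hΨ) K)
    exact continuous_pi fun n => (hfc.compacts_map).comp (continuous_apply n)
  set l := Filter.comap (fun K : ℕ → Compacts E => ((fun n => (K n).map f hfc), ∑' j, a j K))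
    (𝓝 ((fun n => (K n).map f hfc), ∑' j, a j K)) with hl
  have hlt : Filter.Tendsto (fun K : ℕ → Compacts E =>
      ((fun n => (K n).map f hfc), ∑' j, a j K)) l (𝓝 _) := Filter.tendsto_comap
  have hl1 : ∀ n, Filter.Tendsto (fun K : ℕ → Compacts E => (K n).map f hfc) l
      (𝓝 ((K n).map f hfc)) := fun n =>
    (tendsto_pi_nhds.1 ((continuous_fst.tendsto _).comp hlt)) n
  have hl2 : Filter.Tendsto (fun K => ∑' j, a j K) l (𝓝 (∑' j, a j K)) :=
    (continuous_snd.tendsto _).comp hlt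
  -- Along `l`, the image of `K' n` stays inside, respectively meets, the same open sets.
  have hsub : ∀ n {V : Set Z}, IsOpen V → (K n : Set E) ⊆ f ⁻¹' V →
      ∀ᶠ K' in l, (K' n : Set E) ⊆ f ⁻¹' V := fun n V hV h => by
    have := (hl1 n).eventually ((Compacts.isOpen_subsets_of_isOpen hV).mem_nhds
      (show ((K n).map f hfc : Set Z) ⊆ V by rwa [Compacts.coe_map, image_subset_iff]))
    filter_upwards [this] with K' hK'
    rwa [Compacts.coe_map, image_subset_iff] at hK'
  have hhit : ∀ n {V : Set Z}, IsOpen V → ((K n : Set E) ∩ f ⁻¹' V).Nonempty →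
      ∀ᶠ K' in l, ((K' n : Set E) ∩ f ⁻¹' V).Nonempty := fun n V hV h => by
    have := (hl1 n).eventually ((Compacts.isOpen_inter_nonempty_of_isOpen hV).mem_nhds
      (show (((K n).map f hfc : Set Z) ∩ V).Nonempty by
        rwa [Compacts.coe_map, image_inter_nonempty_iff]))
    filter_upwards [this] with K' hK'
    rwa [Compacts.coe_map, image_inter_nonempty_iff] at hK'
  -- The maxima are lower semicontinuous along `l`, hence convergent, as their sum converges.
  have hlow : ∀ j c, c < a j K → ∀ᶠ K' in l, c < a j K' := by
    intro j c hc
    have hwj : (0 : ℝ) < w j := hw0 j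
    rcases lt_or_ge c 0 with h | h
    · exact Filter.Eventually.of_forall fun K' => h.trans_le (ha0 j K')
    have hiff : ∀ K', c < a j K' ↔
        ((K' j.1 : Set E) ∩ {x | x ∈ f ⁻¹' (j.2 : Set Z) ∧ c / w j < β x}).Nonempty := fun K' => by
      rw [← supOn.lt_iff hβc (hCl j.2).1 _ (div_nonneg h hwj.le), div_lt_iff₀' hwj]
    obtain ⟨W, hW, hWβ⟩ := hlsc (c / w j)
    have hset : {x | x ∈ f ⁻¹' (j.2 : Set Z) ∧ c / w j < β x} = f ⁻¹' (j.2 ∩ W) := by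
      rw [preimage_inter, ← hWβ]; rfl
    simp only [hiff, hset] at hc ⊢
    exact hhit j.1 (j.2.isClopen.2.inter hW) hc
  have hup : ∀ n (C : Clopens Z) c, supOn β (f ⁻¹' C) (K n) < c →
      ∀ᶠ K' in l, supOn β (f ⁻¹' C) (K' n) < c := by
    intro n C c hc
    have hwj : (0 : ℝ) < w (n, C) := hw0 _
    have := eventually_lt_of_tendsto_tsum ha0 hsa (hsa K) hlow hl2 (j := (n, C))
      (c := w (n, C) * c) ((mul_lt_mul_iff_right₀ hwj).2 hc)
    filter_upwards [this] with K' hK'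
    exact (mul_lt_mul_iff_right₀ hwj).1 hK'
  refine (tendsto_pi_nhds.2 fun n => tendsto_compacts_nhds ?_ ?_ : Filter.Tendsto id l (𝓝 K))
  · intro U hU hK
    have hloc : ∀ x ∈ (K n : Set E), ∃ (C : Clopens Z) (c : ℝ), f x ∈ C ∧ 0 < c ∧
        supOn β (f ⁻¹' C) (K n) < c ∧ {y | f y ∈ C ∧ β y < c} ⊆ U := fun x hx =>
      exists_clopen_supOn_lt hind hf hβ0 hlsc (K n) hU (hK hx)
    choose! C c hxC hc0 hMc hCU using hloc
    obtain ⟨t, htK⟩ := (K n).isCompact.elim_nhds_subcover' (fun x _ => f ⁻¹' (C x : Set Z))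
      fun x hx => (hCl (C x)).2.mem_nhds (hxC x hx)
    have hVo : IsOpen (⋃ x ∈ t, (C x : Set Z)) := isOpen_biUnion fun x _ => (C x).isClopen.2
    filter_upwards [hsub n hVo (by simpa only [preimage_iUnion] using htK),
      (Filter.eventually_all_finset t).2 fun x _ => hup n (C x) (c x) (hMc x x.2)] with K' h1 h2
    intro y hy
    obtain ⟨x, hxt, hyx⟩ := mem_iUnion₂.1 (show f y ∈ ⋃ x ∈ t, (C x : Set Z) from h1 hy)
    have h3 := h2 x hxt
    rw [supOn.lt_const_iff hβc (hCl (C x)).1 _ (hc0 x x.2)] at h3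
    exact hCU x x.2 ⟨hyx, h3 hy hyx⟩
  · rintro U hU ⟨x, hxK, hxU⟩
    obtain ⟨C, c, hxC, hc0, hMc, hCU⟩ := exists_clopen_supOn_lt hind hf hβ0 hlsc (K n) hU hxU
    filter_upwards [hhit n C.isClopen.2 ⟨x, hxK, hxC⟩, hup n C c hMc] with K' h1 h2
    obtain ⟨y, hyK, hyC⟩ := h1
    rw [supOn.lt_const_iff hβc (hCl C).1 _ hc0] at h2
    exact ⟨y, hyK, hCU ⟨hyC, h2 hyK hyC⟩⟩

end Hyperspace

/-! ### Complete Erdős space -/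

theorem isCompact_convSeq : IsCompact convSeq := by
  have h := (tendsto_one_div_add_atTop_nhds_zero_nat (𝕜 := ℝ)).isCompact_insert_range
  convert! h using 1
  ext t
  simp only [convSeq, singleton_union, mem_insert_iff, mem_ofPred_eq, mem_range]
  refine or_congr_right ⟨?_, ?_⟩
  · rintro ⟨n, hn, rfl⟩
    exact ⟨n - 1, by rw [← Nat.cast_add_one, Nat.sub_add_cancel hn]⟩
  · rintro ⟨n, rfl⟩
    exact ⟨n + 1, n.succ_pos, by push_cast; ring⟩

instance : CompactSpace convSeq := isCompact_iff_compactSpace.1 isCompact_convSeq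

theorem countable_convSeq : convSeq.Countable := by
  refine ((countable_singleton 0).union (countable_range fun n : ℕ => 1 / (n : ℝ))).mono ?_
  rintro t (ht | ⟨n, -, rfl⟩)
  exacts [Or.inl ht, Or.inr ⟨n, rfl⟩]

theorem isZeroDimensional_convSeq : IsZeroDimensional convSeq :=
  isZeroDimensional_of_dense_compl (countable_convSeq.dense_compl ℝ)

instance : TotallySeparatedSpace convSeq :=
  totallySeparatedSpace_of_t0_of_basis_clopen isZeroDimensional_convSeq

theorem nonneg_of_mem_convSeq {t : ℝ} (ht : t ∈ convSeq) : 0 ≤ t := by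
  obtain rfl | ⟨n, -, rfl⟩ := ht
  exacts [le_rfl, by positivity]

namespace lp

local notation "ℓ²" => lp (fun _ : ℕ => ℝ) 2

theorem hasSum_sq (x : ℓ²) : HasSum (fun i => x i ^ 2) (‖x‖ ^ 2) := by
  rw [← real_inner_self_eq_norm_sq]
  convert! lp.hasSum_inner (𝕜 := ℝ) x x using 1
  ext i
  simp [sq]

theorem norm_sub_sq_le {x y : ℓ²} (hx : ∀ i, 0 ≤ x i) (hxy : ∀ i, x i ≤ y i) :
    ‖y - x‖ ^ 2 ≤ ‖y‖ ^ 2 - ‖x‖ ^ 2 := by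
  refine hasSum_le (fun i => ?_) (hasSum_sq (y - x)) ((hasSum_sq y).sub (hasSum_sq x))
  rw [lp.coeFn_sub, Pi.sub_apply]
  nlinarith [hx i, hxy i, mul_nonneg (hx i) (sub_nonneg.2 (hxy i))]

theorem continuous_apply (i : ℕ) : Continuous fun x : ℓ² => x i := by
  refine LipschitzWith.continuous (K := 1) (LipschitzWith.of_dist_le_mul fun x y => ?_)
  rw [NNReal.coe_one, one_mul, dist_eq_norm, dist_eq_norm, ← Pi.sub_apply, ← lp.coeFn_sub]
  exact lp.norm_apply_le_norm two_ne_zero (x - y) i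

/-- In `ℓ²`, coordinatewise convergence together with convergence of the norms implies
convergence. -/
theorem tendsto_of_tendsto_apply_of_tendsto_norm {α : Type*} {l : Filter α} {y : α → ℓ²} {x : ℓ²}
    (hy : ∀ i, Filter.Tendsto (fun a => y a i) l (𝓝 (x i)))
    (hn : Filter.Tendsto (fun a => ‖y a‖) l (𝓝 ‖x‖)) : Filter.Tendsto y l (𝓝 x) := by
  rw [Metric.tendsto_nhds]
  intro ε hε
  -- Compare with a truncation `v` of `x`, for which inner products are finite sums.
  obtain ⟨s, hs⟩ : ∃ s : Finset ℕ, ‖x - ∑ i ∈ s, lp.single 2 i (x i)‖ < ε / 2 := by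
    have := (lp.hasSum_single (E := fun _ : ℕ => ℝ) (p := 2) (by simp) x).eventually
      (Metric.ball_mem_nhds x (half_pos hε))
    obtain ⟨s, hs⟩ := this.exists
    exact ⟨s, by rw [← dist_eq_norm, dist_comm]; exact hs⟩
  set v : ℓ² := ∑ i ∈ s, lp.single 2 i (x i) with hv
  have hinner : ∀ z : ℓ², inner ℝ z v = ∑ i ∈ s, x i * z i := fun z => by
    rw [hv, inner_sum]
    refine Finset.sum_congr rfl fun i _ => ?_
    rw [lp.inner_single_right]
    simp
  have hsq : Filter.Tendsto (fun a => ‖y a - v‖ ^ 2) l (𝓝 (‖x - v‖ ^ 2)) := by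
    simp only [norm_sub_sq_real, hinner]
    exact ((hn.pow 2).sub
      ((tendsto_finsetSum _ fun i _ => (hy i).const_mul _).const_mul _)).add_const _
  have := hsq.eventually (gt_mem_nhds (pow_lt_pow_left₀ hs (norm_nonneg _) two_ne_zero))
  filter_upwards [this] with a ha
  have h1 := lt_of_pow_lt_pow_left₀ 2 (half_pos hε).le ha
  rw [dist_eq_norm]
  calc ‖y a - x‖ = ‖(y a - v) - (x - v)‖ := by congr 1; abel
    _ ≤ ‖y a - v‖ + ‖x - v‖ := norm_sub_le _ _
    _ < ε := by linarith

end lp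

namespace completeErdos

theorem isClosed : IsClosed completeErdos := by
  have : completeErdos = ⋂ i, {x : lp (fun _ : ℕ => ℝ) 2 | x i ∈ convSeq} := by
    ext x
    simp only [mem_iInter]
    exact Iff.rfl
  rw [this]
  exact isClosed_iInter fun i => isCompact_convSeq.isClosed.preimage (lp.continuous_apply i)

/-- The origin of complete Erdős space. -/
noncomputable def zero : completeErdos := ⟨0, fun _ => Or.inl rfl⟩

/-- The coordinates of a point of complete Erdős space, as a point of the compact zero-dimensional
space `ℕ → convSeq`. -/
noncomputable def coord (x : completeErdos) : ℕ → convSeq := fun i => ⟨x.1 i, x.2 i⟩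

/-- A bounded strictly increasing function of the norm. Its boundedness makes weighted
sums of its maxima converge. -/
noncomputable def height (x : completeErdos) : ℝ := ‖x.1‖ ^ 2 / (1 + ‖x.1‖ ^ 2)

theorem continuous_coord : Continuous coord :=
  continuous_pi fun i => ((lp.continuous_apply i).comp continuous_subtype_val).subtype_mk _

theorem injective_coord : Function.Injective coord := fun x y h => by
  refine Subtype.ext (lp.ext (funext fun i => ?_))
  exact congrArg Subtype.val (congrFun h i)

theorem continuous_height : Continuous height := by
  have h : Continuous fun x : completeErdos => ‖x.1‖ := continuous_norm.comp continuous_subtype_val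
  exact (h.pow 2).div (continuous_const.add (h.pow 2)) fun x => by positivity

theorem height_nonneg (x : completeErdos) : 0 ≤ height x := by
  unfold height; positivity

theorem height_le_one (x : completeErdos) : height x ≤ 1 :=
  div_le_one_of_le₀ (by linarith) (by positivity)

theorem norm_sq_eq (x : completeErdos) : ‖x.1‖ ^ 2 = height x / (1 - height x) := by
  have h : (1 + ‖x.1‖ ^ 2) ≠ 0 := by positivity
  rw [height]
  field_simp
  ring

theorem height_lt_one (x : completeErdos) : height x < 1 := by
  rw [height, div_lt_one (by positivity)]
  linarith

/-- The topology of complete Erdős space is generated by the coordinates and the norm. -/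
theorem isInducing_coord_height : IsInducing fun x : completeErdos => (coord x, height x) := by
  refine isInducing_iff_nhds.2 fun x => le_antisymm
    (Filter.map_le_iff_le_comap.1 ((continuous_coord.prodMk continuous_height).tendsto x)) ?_
  set l := Filter.comap (fun y : completeErdos => (coord y, height y)) (𝓝 (coord x, height x))
  have hl : Filter.Tendsto (fun y : completeErdos => (coord y, height y)) l
    (𝓝 (coord x, height x)) := Filter.tendsto_comap
  have hh : Filter.Tendsto height l (𝓝 (height x)) := (continuous_snd.tendsto _).comp hl
  have hc : ∀ i, Filter.Tendsto (fun y : completeErdos => y.1 i) l (𝓝 (x.1 i)) := fun i =>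
    ((show Continuous fun p : (ℕ → convSeq) × ℝ => (p.1 i : ℝ) by fun_prop).tendsto
      (coord x, height x)).comp hl
  have hn : Filter.Tendsto (fun y : completeErdos => ‖y.1‖) l (𝓝 ‖x.1‖) := by
    have h2 : Filter.Tendsto (fun y : completeErdos => ‖y.1‖ ^ 2) l (𝓝 (‖x.1‖ ^ 2)) := by
      simp only [norm_sq_eq]
      exact hh.div (hh.const_sub 1) (sub_ne_zero.2 (height_lt_one x).ne')
    simpa [Real.sqrt_sq (norm_nonneg _)] using h2.sqrt
  have : Filter.Tendsto id l (𝓝 x) :=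
    tendsto_subtype_rng.2 (lp.tendsto_of_tendsto_apply_of_tendsto_norm hc hn)
  exact this

instance : SecondCountableTopology completeErdos :=
  isInducing_coord_height.secondCountableTopology

/-- The height is lower semicontinuous for the topology of coordinatewise convergence, since the
norm is the supremum of the norms of the truncations. -/
theorem exists_isOpen_lt_height (c : ℝ) :
    ∃ W : Set (ℕ → convSeq), IsOpen W ∧ {x | c < height x} = coord ⁻¹' W := by
  have hpos : ∀ (s : Finset ℕ) (z : ℕ → convSeq), 0 ≤ ∑ i ∈ s, (z i : ℝ) ^ 2 := fun s z =>
    Finset.sum_nonneg fun i _ => sq_nonneg _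
  refine ⟨⋃ s : Finset ℕ, {z | c < (∑ i ∈ s, (z i : ℝ) ^ 2) / (1 + ∑ i ∈ s, (z i : ℝ) ^ 2)},
    isOpen_iUnion fun s => isOpen_lt continuous_const ?_, ?_⟩
  · have : Continuous fun z : ℕ → convSeq => ∑ i ∈ s, (z i : ℝ) ^ 2 :=
      continuous_finsetSum _ fun i _ => (continuous_subtype_val.comp (continuous_apply i)).pow 2
    exact this.div (continuous_const.add this) fun z => by linarith [hpos s z]
  · ext x
    simp only [mem_ofPred_eq, mem_preimage, mem_iUnion]
    have hsum := lp.hasSum_sq x.1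
    constructor
    · intro h
      have : Filter.Tendsto (fun s : Finset ℕ => (∑ i ∈ s, x.1 i ^ 2) / (1 + ∑ i ∈ s, x.1 i ^ 2))
          Filter.atTop (𝓝 (height x)) :=
        Filter.Tendsto.div hsum (Filter.Tendsto.const_add 1 hsum) (by positivity)
      exact (this.eventually (lt_mem_nhds h)).exists
    · rintro ⟨s, hs⟩
      refine hs.trans_le ?_
      have h1 : ∑ i ∈ s, (coord x i : ℝ) ^ 2 ≤ ‖x.1‖ ^ 2 :=
        sum_le_hasSum s (fun i _ => sq_nonneg _) hsum
      have h2 := hpos s (coord x)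
      rw [height, div_le_div_iff₀ (by positivity) (by positivity)]
      nlinarith

/-- A nonempty bounded closed subset of complete Erdős space has a coordinatewise maximal element:
a greedily chosen increasing sequence converges, because
`‖y - x‖ ^ 2 ≤ ‖y‖ ^ 2 - ‖x‖ ^ 2` whenever `0 ≤ x ≤ y`. -/
theorem exists_maximal {C : Set completeErdos} (hC : IsClosed C) (hne : C.Nonempty) {R : ℝ}
    (hR : ∀ x ∈ C, ‖x.1‖ ^ 2 ≤ R) :
    ∃ x ∈ C, ∀ y ∈ C, (∀ i, x.1 i ≤ y.1 i) → y = x := by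
  have hnn : ∀ (x : completeErdos) i, 0 ≤ x.1 i := fun x i => nonneg_of_mem_convSeq (x.2 i)
  have hstep : ∀ (n : ℕ) (x : C), ∃ y : C, (∀ i, x.1.1 i ≤ y.1.1 i) ∧
      ∀ z ∈ C, (∀ i, x.1.1 i ≤ z.1 i) → ‖z.1‖ ^ 2 ≤ ‖y.1.1‖ ^ 2 + 1 / ((n : ℝ) + 1) := by
    intro n x
    set S : Set ℝ := (fun z : completeErdos => ‖z.1‖ ^ 2) '' {z | z ∈ C ∧ ∀ i, x.1.1 i ≤ z.1 i}
    have hS : BddAbove S := ⟨R, by rintro _ ⟨z, hz, rfl⟩; exact hR z hz.1⟩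
    obtain ⟨_, ⟨y, hy, rfl⟩, hlt⟩ := exists_lt_of_lt_csSup (s := S)
      (b := sSup S - 1 / ((n : ℝ) + 1))
      ⟨_, x.1, ⟨x.2, fun i => le_rfl⟩, rfl⟩ (sub_lt_self _ (by positivity))
    refine ⟨⟨y, hy.1⟩, hy.2, fun z hz hxz => ?_⟩
    have : ‖z.1‖ ^ 2 ≤ sSup S := le_csSup hS ⟨z, ⟨hz, hxz⟩, rfl⟩
    simp only at hlt
    linarith
  choose F hF1 hF2 using hstep
  obtain ⟨x₀, hx₀⟩ := hne
  let u : ℕ → C := fun n => Nat.rec ⟨x₀, hx₀⟩ F n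
  have hu : ∀ n, u (n + 1) = F n (u n) := fun n => rfl
  have humono : ∀ i, Monotone fun n => (u n).1.1 i := fun i => monotone_nat_of_le_succ fun n => by
    simp only [hu]
    exact hF1 n (u n) i
  have hdist : ∀ {m n}, m ≤ n →
      ‖(u n).1.1 - (u m).1.1‖ ^ 2 ≤ ‖(u n).1.1‖ ^ 2 - ‖(u m).1.1‖ ^ 2 := fun h =>
    lp.norm_sub_sq_le (hnn _) fun i => humono i h
  have hsqmono : Monotone fun n => ‖(u n).1.1‖ ^ 2 := fun m n h => by
    have := hdist h
    have := sq_nonneg ‖(u n).1.1 - (u m).1.1‖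
    simp only
    linarith
  have hconv := tendsto_atTop_ciSup hsqmono ⟨R, by rintro _ ⟨n, rfl⟩; exact hR _ (u n).2⟩
  set L := ⨆ n, ‖(u n).1.1‖ ^ 2
  have hle : ∀ n, ‖(u n).1.1‖ ^ 2 ≤ L := fun n => hsqmono.ge_of_tendsto hconv n
  have hcauchy : CauchySeq fun n => (u n).1.1 := by
    refine Metric.cauchySeq_iff'.2 fun ε hε => ?_
    obtain ⟨N, hN⟩ := (hconv.eventually (lt_mem_nhds (sub_lt_self L (pow_pos hε 2)))).exists
    refine ⟨N, fun n hn => ?_⟩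
    rw [dist_eq_norm]
    refine lt_of_pow_lt_pow_left₀ 2 hε.le ?_
    have := hdist hn
    have := hle n
    linarith
  obtain ⟨v, hv⟩ := cauchySeq_tendsto_of_complete hcauchy
  have hvE : v ∈ completeErdos := isClosed.mem_of_tendsto hv (Filter.Eventually.of_forall fun n =>
    (u n).1.2)
  have hvC : (⟨v, hvE⟩ : completeErdos) ∈ C :=
    hC.mem_of_tendsto (tendsto_subtype_rng.2 hv) (Filter.Eventually.of_forall fun n => (u n).2)
  have huv : ∀ n i, (u n).1.1 i ≤ v i := fun n i =>
    (humono i).ge_of_tendsto (((lp.continuous_apply i).tendsto v).comp hv) n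
  refine ⟨_, hvC, fun z hz hvz => ?_⟩
  have hzv : ‖z.1‖ ^ 2 ≤ ‖v‖ ^ 2 := by
    have h1 : Filter.Tendsto (fun n => ‖(u (n + 1)).1.1‖ ^ 2 + 1 / ((n : ℝ) + 1)) Filter.atTop
        (𝓝 (‖v‖ ^ 2 + 0)) :=
      ((hv.norm.pow 2).comp (Filter.tendsto_add_atTop_nat 1)).add
        tendsto_one_div_add_atTop_nhds_zero_nat
    rw [add_zero] at h1
    refine ge_of_tendsto' h1 fun n => ?_
    rw [hu]
    exact hF2 n (u n) z hz fun i => (huv n i).trans (hvz i)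
  have h0 := lp.norm_sub_sq_le (hnn ⟨v, hvE⟩) hvz
  have h1 : ‖z.1 - v‖ ^ 2 ≤ 0 := by simp only at h0; linarith
  have h2 : ‖z.1 - v‖ = 0 := by
    have := sq_nonneg ‖z.1 - v‖
    exact pow_eq_zero_iff two_ne_zero |>.1 (le_antisymm h1 this)
  exact Subtype.ext (sub_eq_zero.1 (norm_eq_zero.1 h2))

/-- Erdős's theorem: nonempty clopen subsets of complete Erdős space are unbounded. A bounded one
would have a coordinatewise maximal element, but in an open set a sufficiently far coordinate of
any point can be raised to `1 / n`. -/
theorem exists_lt_norm_of_isClopen {C : Set completeErdos} (hC : IsClopen C) (hne : C.Nonempty)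
    (R : ℝ) : ∃ x ∈ C, R < ‖x.1‖ := by
  by_contra! hR
  obtain ⟨x, hx, hmax⟩ := exists_maximal hC.1 hne (R := R ^ 2) fun x hx =>
    pow_le_pow_left₀ (norm_nonneg _) (hR x hx) 2
  obtain ⟨ε, hε, hball⟩ := Metric.isOpen_iff.1 hC.2 x hx
  obtain ⟨n, hn⟩ := exists_nat_one_div_lt hε
  have hpos : (0 : ℝ) < 1 / ((n : ℝ) + 1) := by positivity
  obtain ⟨i, hi⟩ := ((lp.hasSum_sq x.1).summable.tendsto_cofinite_zero.eventually
    (gt_mem_nhds (pow_pos hpos 2))).exists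
  have hlt : x.1 i < 1 / ((n : ℝ) + 1) := lt_of_pow_lt_pow_left₀ 2 hpos.le hi
  have hx0 : 0 ≤ x.1 i := nonneg_of_mem_convSeq (x.2 i)
  set z : lp (fun _ : ℕ => ℝ) 2 := x.1 + lp.single 2 i (1 / ((n : ℝ) + 1) - x.1 i) with hz
  have hzi : z i = 1 / ((n : ℝ) + 1) := by simp [hz]
  have hzj : ∀ j, j ≠ i → z j = x.1 j := fun j hj => by
    simp [hz, hj]
  have hzE : z ∈ completeErdos := fun j => by
    by_cases h : j = i
    · subst h
      exact Or.inr ⟨n + 1, n.succ_pos, by rw [hzi]; push_cast; rfl⟩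
    · rw [hzj j h]
      exact x.2 j
  have hzC : (⟨z, hzE⟩ : completeErdos) ∈ C := by
    refine hball ?_
    rw [Metric.mem_ball, Subtype.dist_eq, dist_eq_norm]
    change ‖z - x.1‖ < ε
    rw [hz, add_sub_cancel_left,
      lp.norm_single (by norm_num), Real.norm_of_nonneg (by linarith)]
    linarith
  have heq := hmax _ hzC fun j => by
    by_cases h : j = i
    · subst h
      exact hlt.le.trans_eq hzi.symm
    · exact (hzj j h).ge
  have : z i = x.1 i := by rw [← heq]
  rw [hzi] at this
  exact hlt.ne' this

end completeErdos

/-! ### The topology of `spaceP` -/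

/-- The point `1 / (n + 1)` of the convergent sequence. -/
noncomputable def convSeq.term (n : ℕ) : convSeq :=
  ⟨1 / ((n : ℝ) + 1), Or.inr ⟨n + 1, n.succ_pos, by push_cast; rfl⟩⟩

theorem convSeq.term_lt_term {m n : ℕ} : term m < term n ↔ n < m := by
  rw [← Subtype.coe_lt_coe, term, term]
  simp only
  rw [one_div_lt_one_div (by positivity) (by positivity)]
  simp

theorem convSeq.isOpen_singleton_term (n : ℕ) : IsOpen {term n} := by
  have hpos : (0 : ℝ) < 1 / ((n : ℝ) + 1) := by positivity
  refine isOpen_singleton_iff_nhds_eq_pure _ |>.2 (le_antisymm ?_ (pure_le_nhds _))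
  rw [Filter.le_pure_iff]
  have hc : ContinuousAt (fun t : convSeq => (t : ℝ)⁻¹) (term n) :=
    continuous_subtype_val.continuousAt.inv₀ hpos.ne'
  filter_upwards [hc.preimage_mem_nhds (Metric.ball_mem_nhds _ one_pos),
    continuous_subtype_val.continuousAt.preimage_mem_nhds (lt_mem_nhds hpos)] with t ht1 ht0
  rw [mem_preimage, Metric.mem_ball, Real.dist_eq] at ht1
  obtain ⟨t, ht | ⟨m, hm, rfl⟩⟩ := t
  · exact absurd ht (ne_of_gt ht0)
  · simp only [term, one_div, inv_inv] at ht1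
    have h1 := abs_lt.1 ht1
    have h2 : m = n + 1 := by
      have : (m : ℝ) < n + 2 := by linarith [h1.2]
      have : (n : ℝ) < m := by linarith [h1.1]
      norm_cast at *
      omega
    subst h2
    exact Subtype.ext (by simp [term])

theorem CompleteErdosPlus.continuous_ofErdos : Continuous CompleteErdosPlus.ofErdos :=
  ⟨fun _ hU => hU.1⟩

theorem CompleteErdosPlus.isOpenMap_ofErdos : IsOpenMap CompleteErdosPlus.ofErdos := by
  intro U hU
  have hinj : Function.Injective CompleteErdosPlus.ofErdos := fun _ _ h =>
    CompleteErdosPlus.ofErdos.inj h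
  refine ⟨by rwa [hinj.preimage_image], ?_⟩
  rintro ⟨x, -, hx⟩
  cases hx

/-- In an almost zero-dimensional space, every point has arbitrarily small neighbourhoods that are
intersections of clopen sets. -/
theorem IsAlmostZeroDimensional.exists_isClopen {X : Type*} [T : TopologicalSpace X]
    (h : IsAlmostZeroDimensional X) {x : X} {U : Set X} (hU : U ∈ 𝓝 x) :
    ∃ V ∈ 𝓝 x, V ⊆ U ∧ ∀ y ∉ V, ∃ C, IsClopen C ∧ y ∈ C ∧ C ⊆ Vᶜ := by
  obtain ⟨W, hTW, hW, h⟩ := h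
  obtain ⟨V, hV, hVU, hVc⟩ := h x U hU
  refine ⟨V, hV, hVU, fun y hy => ?_⟩
  have hn : Vᶜ ∈ @nhds X W y := hVc.isOpen_compl.mem_nhds hy
  obtain ⟨C, hC, hyC, hCV⟩ := (@isZeroDimensional_iff X W).1 hW y Vᶜ hn
  exact ⟨C, ⟨hC.1.mono hTW, hC.2.mono hTW⟩, hyC, hCV⟩

namespace spaceP

/-- The inclusion of complete Erdős space as the slice of `spaceP` at height `1 / (n + 1)`. -/
noncomputable def slice (n : ℕ) (x : completeErdos) : spaceP :=
  ⟨(.ofErdos x, convSeq.term n), Or.inl ⟨⟨x, rfl⟩, n + 1, n.succ_pos, by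
    simp [convSeq.term]⟩⟩

/-- The point `(p, 0)` of `spaceP`. -/
def apex : spaceP :=
  ⟨(.p, ⟨0, Or.inl rfl⟩), Or.inr ⟨rfl, rfl⟩⟩

/-- The projection of `spaceP` to the convergent sequence. -/
def proj (z : spaceP) : convSeq := z.1.2

theorem continuous_proj : Continuous proj := continuous_snd.comp continuous_subtype_val

theorem eq_apex_or_slice (z : spaceP) : z = apex ∨ ∃ n x, z = slice n x := by
  obtain ⟨⟨e, t, ht⟩, ⟨⟨x, hx⟩, n, hn, hnt⟩ | ⟨he, ht0⟩⟩ := z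
  · refine Or.inr ⟨n - 1, x, Subtype.ext (Prod.ext hx (Subtype.ext ?_))⟩
    simp only [slice, convSeq.term] at hnt ⊢
    rw [hnt, ← Nat.cast_add_one, Nat.sub_add_cancel hn]
  · exact Or.inl (Subtype.ext (Prod.ext he (Subtype.ext ht0)))

theorem slice_ne_apex (n : ℕ) (x : completeErdos) : slice n x ≠ apex := fun h => by
  have := congrArg (fun z : spaceP => z.1.1) h
  cases this

theorem slice_inj {m n : ℕ} {x y : completeErdos} : slice m x = slice n y ↔ m = n ∧ x = y := by
  constructor
  · intro h
    refine ⟨?_, CompleteErdosPlus.ofErdos.inj (congrArg (fun z : spaceP => z.1.1) h)⟩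
    have h2 : convSeq.term m = convSeq.term n := congrArg proj h
    exact le_antisymm (not_lt.1 fun h => (convSeq.term_lt_term.2 h).ne h2)
      (not_lt.1 fun h => (convSeq.term_lt_term.2 h).ne' h2)
  · rintro ⟨rfl, rfl⟩
    rfl

theorem continuous_slice (n : ℕ) : Continuous (slice n) :=
  (CompleteErdosPlus.continuous_ofErdos.prodMk continuous_const).subtype_mk _

/-- The topology of `spaceP`: a set is open if its slices are open and, in case it contains the
apex, it contains all points of large norm in all slices of large index. -/
theorem isOpen_iff {U : Set spaceP} : IsOpen U ↔ (∀ n, IsOpen (slice n ⁻¹' U)) ∧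
    (apex ∈ U → ∃ N : ℕ, ∀ n ≥ N, ∀ x, (N : ℝ) < ‖x.1‖ → slice n x ∈ U) := by
  constructor
  · intro hU
    refine ⟨fun n => hU.preimage (continuous_slice n), fun hp => ?_⟩
    obtain ⟨V, hV, hVU⟩ := mem_nhds_subtype _ _ _ |>.1 (hU.mem_nhds hp)
    rw [nhds_prod_eq] at hV
    obtain ⟨A, hA, B, hB, hAB⟩ := Filter.mem_prod_iff.1 hV
    obtain ⟨A', hA'A, hA', hpA'⟩ := mem_nhds_iff.1 hA
    obtain ⟨R, hR⟩ := (Bornology.isBounded_image_subtype_val.2 (hA'.2 hpA')).exists_norm_le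
    obtain ⟨δ, hδ, hδB⟩ := Metric.mem_nhds_iff.1 hB
    obtain ⟨N₁, hN₁⟩ := exists_nat_one_div_lt hδ
    obtain ⟨N₂, hN₂⟩ := exists_nat_ge R
    refine ⟨max N₁ N₂, fun n hn x hx => hVU (hAB ⟨hA'A ?_, hδB ?_⟩)⟩
    · by_contra h
      have h1 := hR x.1 ⟨x, h, rfl⟩
      have h2 : (N₂ : ℝ) ≤ (max N₁ N₂ : ℕ) := by exact_mod_cast le_max_right _ _
      linarith
    · rw [Metric.mem_ball, Subtype.dist_eq, Real.dist_eq]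
      simp only [slice, convSeq.term, apex, sub_zero]
      rw [abs_of_pos (by positivity)]
      refine lt_of_le_of_lt (one_div_le_one_div_of_le (by positivity) ?_) hN₁
      have : (N₁ : ℝ) ≤ n := by exact_mod_cast (le_max_left _ _).trans hn
      linarith
  · rintro ⟨hs, hp⟩
    refine isOpen_iff_mem_nhds.2 fun z hz => ?_
    obtain rfl | ⟨n, x, rfl⟩ := eq_apex_or_slice z
    · obtain ⟨N, hN⟩ := hp hz
      have hA : IsOpen {e : CompleteErdosPlus | ∀ x, e = .ofErdos x → (N : ℝ) < ‖x.1‖} := by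
        have hpre : CompleteErdosPlus.ofErdos ⁻¹' {e | ∀ x, e = .ofErdos x → (N : ℝ) < ‖x.1‖} =
            {x | (N : ℝ) < ‖x.1‖} := by
          ext x
          simp only [mem_preimage, mem_ofPred_eq, CompleteErdosPlus.ofErdos.injEq]
          exact ⟨fun h => h x rfl, fun h y hy => hy ▸ h⟩
        refine ⟨?_, fun _ => ?_⟩
        · rw [hpre]
          exact isOpen_lt continuous_const (continuous_norm.comp continuous_subtype_val)
        · rw [hpre]
          refine Bornology.isBounded_image_subtype_val.1 (isBounded_iff_forall_norm_le.2 ⟨N, ?_⟩)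
          rintro _ ⟨x, hx, rfl⟩
          exact not_lt.1 hx
      have hB : IsOpen {t : convSeq | t < convSeq.term N} :=
        isOpen_lt continuous_id continuous_const
      have h0 : (0 : ℝ) < 1 / ((N : ℝ) + 1) := by positivity
      refine Filter.mem_of_superset ((hA.prod hB).preimage continuous_subtype_val |>.mem_nhds
        (show apex ∈ _ from ⟨fun x hx => CompleteErdosPlus.noConfusion hx, h0⟩)) ?_
      · rintro w ⟨hw1, hw2⟩
        obtain rfl | ⟨n, x, rfl⟩ := eq_apex_or_slice w
        · exact hz
        · exact hN n (convSeq.term_lt_term.1 hw2).le x (hw1 x rfl)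
    · refine Filter.mem_of_superset (((CompleteErdosPlus.isOpenMap_ofErdos _ (hs n)).prod
        (convSeq.isOpen_singleton_term n)).preimage continuous_subtype_val |>.mem_nhds
          ⟨⟨x, hz, rfl⟩, rfl⟩) ?_
      rintro w ⟨⟨y, hy, hyw⟩, hw⟩
      have : w = slice n y := Subtype.ext (Prod.ext hyw.symm hw)
      rwa [this]

theorem isOpen_image_slice (n : ℕ) {U : Set completeErdos} (hU : IsOpen U) :
    IsOpen (slice n '' U) := by
  refine isOpen_iff.2 ⟨fun m => ?_, ?_⟩
  · by_cases h : m = n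
    · subst h
      rwa [preimage_image_eq _ fun x y h => (slice_inj.1 h).2]
    · convert! isOpen_empty using 1
      refine eq_empty_of_forall_notMem ?_
      rintro x ⟨y, -, hy⟩
      exact h (slice_inj.1 hy).1.symm
  · rintro ⟨x, -, hx⟩
    exact absurd hx (slice_ne_apex n x)

theorem isClosed_image_slice (n : ℕ) {C : Set completeErdos} (hC : IsClosed C) :
    IsClosed (slice n '' C) := by
  refine ⟨isOpen_iff.2 ⟨fun m => ?_, fun _ => ⟨n + 1, ?_⟩⟩⟩
  · by_cases h : m = n
    · subst h
      rw [preimage_compl, preimage_image_eq _ fun x y h => (slice_inj.1 h).2]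
      exact hC.isOpen_compl
    · convert! isOpen_univ using 1
      refine eq_univ_of_forall ?_
      rintro x ⟨y, -, hy⟩
      exact h (slice_inj.1 hy).1.symm
  · rintro m hm x - ⟨y, -, hy⟩
    have := (slice_inj.1 hy).1
    omega

theorem isClosedEmbedding_slice (n : ℕ) : IsClosedEmbedding (slice n) where
  toIsEmbedding := (IsOpenEmbedding.of_continuous_injective_isOpenMap (continuous_slice n)
    (fun _ _ h => (slice_inj.1 h).2) fun _ hU => isOpen_image_slice n hU).isEmbedding
  isClosed_range := by
    rw [← image_univ]
    exact isClosed_image_slice n isClosed_univ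

/-- The points of `spaceP` outside the first `N` slices, except those of norm at most `k`. -/
def tail (N k : ℕ) : Set spaceP := {z | ∀ n x, z = slice n x → N ≤ n ∧ (k : ℝ) < ‖x.1‖}

theorem slice_mem_tail {N k n : ℕ} {x : completeErdos} :
    slice n x ∈ tail N k ↔ N ≤ n ∧ (k : ℝ) < ‖x.1‖ := by
  refine ⟨fun h => h n x rfl, fun h m y hy => ?_⟩
  obtain ⟨rfl, rfl⟩ := slice_inj.1 hy
  exact h

theorem apex_mem_tail (N k : ℕ) : apex ∈ tail N k := fun n x h =>
  absurd h.symm (slice_ne_apex n x)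

theorem isOpen_tail (N k : ℕ) : IsOpen (tail N k) := by
  refine isOpen_iff.2 ⟨fun n => ?_, fun _ => ⟨max N k, fun n hn x hx => slice_mem_tail.2 ⟨?_, ?_⟩⟩⟩
  · have : slice n ⁻¹' tail N k = {x | N ≤ n ∧ (k : ℝ) < ‖x.1‖} := by
      ext x
      exact slice_mem_tail
    rw [this]
    by_cases h : N ≤ n
    · simp only [h, true_and]
      exact isOpen_lt continuous_const (continuous_norm.comp continuous_subtype_val)
    · simp only [h, false_and]
      exact isOpen_empty
  · exact (le_max_left _ _).trans hn
  · refine lt_of_le_of_lt ?_ hx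
    exact_mod_cast le_max_right N k

theorem exists_tail_subset {U : Set spaceP} (hU : U ∈ 𝓝 apex) : ∃ N, tail N N ⊆ U := by
  obtain ⟨V, hVU, hV, hp⟩ := mem_nhds_iff.1 hU
  obtain ⟨N, hN⟩ := (isOpen_iff.1 hV).2 hp
  refine ⟨N, fun z hz => hVU ?_⟩
  obtain rfl | ⟨n, x, rfl⟩ := eq_apex_or_slice z
  · exact hp
  · rw [slice_mem_tail] at hz
    exact hN n hz.1 x hz.2

instance : SecondCountableTopology spaceP := by
  refine IsTopologicalBasis.secondCountableTopology
    (b := range (fun N => tail N N) ∪ ⋃ n, (slice n '' ·) '' countableBasis completeErdos) ?_ ?_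
  · refine isTopologicalBasis_of_isOpen_of_nhds ?_ fun z U hz hU => ?_
    · rintro V (⟨N, rfl⟩ | hV)
      · exact isOpen_tail N N
      · obtain ⟨n, B, hB, rfl⟩ := mem_iUnion.1 hV
        exact isOpen_image_slice n (isOpen_of_mem_countableBasis hB)
    · obtain rfl | ⟨n, x, rfl⟩ := eq_apex_or_slice z
      · obtain ⟨N, hN⟩ := exists_tail_subset (hU.mem_nhds hz)
        exact ⟨_, Or.inl ⟨N, rfl⟩, apex_mem_tail N N, hN⟩
      · obtain ⟨B, hB, hxB, hBU⟩ := (isBasis_countableBasis completeErdos).exists_subset_of_mem_open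
          hz (hU.preimage (continuous_slice n))
        exact ⟨_, Or.inr (mem_iUnion.2 ⟨n, B, hB, rfl⟩), mem_image_of_mem _ hxB,
          image_subset_iff.2 hBU⟩
  · exact (countable_range _).union (countable_iUnion fun n => (countable_countableBasis _).image _)

instance : TotallySeparatedSpace spaceP := by
  have hcl : ∀ n {C : Set completeErdos}, IsClopen C → IsClopen (slice n '' C) := fun n C hC =>
    ⟨isClosed_image_slice n hC.1, isOpen_image_slice n hC.2⟩
  refine totallySeparatedSpace_iff_exists_isClopen.2 fun z w hzw => ?_
  obtain rfl | ⟨n, x, rfl⟩ := eq_apex_or_slice z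
  · obtain rfl | ⟨m, y, rfl⟩ := eq_apex_or_slice w
    · exact absurd rfl hzw
    · refine ⟨_, (hcl m isClopen_univ).compl, ?_, not_not.2 ⟨y, trivial, rfl⟩⟩
      rintro ⟨x, -, hx⟩
      exact slice_ne_apex m x hx
  · by_cases hw : ∃ y, w = slice n y
    · obtain ⟨y, rfl⟩ := hw
      have hne : completeErdos.coord x ≠ completeErdos.coord y := fun h =>
        hzw (by rw [completeErdos.injective_coord h])
      obtain ⟨C, hC, hxC, hyC⟩ := exists_isClopen_of_totally_separated hne
      refine ⟨_, hcl n (hC.preimage completeErdos.continuous_coord), ⟨x, hxC, rfl⟩, ?_⟩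
      rintro ⟨y', hy', h⟩
      obtain rfl := (slice_inj.1 h).2
      exact hyC hy'
    · refine ⟨_, hcl n isClopen_univ, ⟨x, trivial, rfl⟩, ?_⟩
      rintro ⟨y, -, hy⟩
      exact hw ⟨y, hy.symm⟩

instance : RegularSpace spaceP := by
  refine RegularSpace.of_exists_mem_nhds_isClosed_subset fun z U hU => ?_
  obtain rfl | ⟨n, x, rfl⟩ := eq_apex_or_slice z
  · obtain ⟨N, hN⟩ := exists_tail_subset hU
    refine ⟨closure (tail N (N + 1)), Filter.mem_of_superset
      ((isOpen_tail N (N + 1)).mem_nhds (apex_mem_tail _ _)) subset_closure, isClosed_closure, ?_⟩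
    refine Subset.trans (fun z hz => ?_) hN
    obtain rfl | ⟨n, x, rfl⟩ := eq_apex_or_slice z
    · exact apex_mem_tail N N
    by_contra hx
    -- Near a point of `slice n` of norm at most `N`, all norms are less than `N + 1`.
    have hV : IsOpen {y : completeErdos | n < N ∨ ‖y.1‖ < N + 1} := by
      by_cases h : n < N
      · simp only [h, true_or]
        exact isOpen_univ
      · simp only [h, false_or]
        exact isOpen_lt (continuous_norm.comp continuous_subtype_val) continuous_const
    obtain ⟨w, ⟨y, hy, rfl⟩, hw⟩ := mem_closure_iff.1 hz _ (isOpen_image_slice n hV) ⟨x, by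
      rw [slice_mem_tail, not_and_or, not_le, not_lt] at hx
      exact hx.imp_right fun h => by linarith, rfl⟩
    rw [slice_mem_tail] at hw
    push_cast at hw
    exact hy.elim hw.1.not_gt hw.2.not_gt
  · obtain ⟨V, hV, hVc, hVU⟩ := exists_mem_nhds_isClosed_subset
      ((continuous_slice n).continuousAt.preimage_mem_nhds hU)
    refine ⟨slice n '' V, ?_, isClosed_image_slice n hVc, image_subset_iff.2 hVU⟩
    exact Filter.mem_of_superset ((isOpen_image_slice n isOpen_interior).mem_nhds
      (mem_image_of_mem _ (mem_interior_iff_mem_nhds.2 hV))) (image_mono interior_subset)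

/-- In a coarser zero-dimensional topology `W`, a `W`-closed neighbourhood `V` of the apex avoiding
the origins of the slices could be separated from such an origin by a clopen set. In a slice of
large index, where `V` contains all points of large norm, this would be a bounded clopen set. -/
theorem not_isAlmostZeroDimensional : ¬ IsAlmostZeroDimensional spaceP := by
  intro h
  obtain ⟨V, hV, hVsub, hsep⟩ := h.exists_isClopen ((isOpen_tail 0 0).mem_nhds (apex_mem_tail 0 0))
  obtain ⟨N, hN⟩ := exists_tail_subset hV
  have h0 : slice N completeErdos.zero ∉ V := fun h => by
    have := (slice_mem_tail.1 (hVsub h)).2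
    simp [completeErdos.zero] at this
  obtain ⟨C, hC, h0C, hCV⟩ := hsep _ h0
  obtain ⟨x, hxC, hx⟩ := completeErdos.exists_lt_norm_of_isClopen
    (hC.preimage (continuous_slice N)) ⟨_, h0C⟩ N
  exact hCV hxC (hN (slice_mem_tail.2 ⟨le_rfl, hx⟩))

end spaceP

/-- A space containing a continuous image of complete Erdős space is not zero-dimensional if some
neighbourhood of the image of the origin has bounded preimage. -/
theorem completeErdos.not_isZeroDimensional {X : Type*} [TopologicalSpace X] {f : completeErdos → X}
    (hf : Continuous f) {U : Set X} (hU : U ∈ 𝓝 (f completeErdos.zero)) {R : ℝ}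
    (hR : ∀ x, f x ∈ U → ‖x.1‖ ≤ R) : ¬ IsZeroDimensional X := by
  intro h
  obtain ⟨C, hC, h0, hCU⟩ := isZeroDimensional_iff.1 h _ U hU
  obtain ⟨x, hxC, hx⟩ := completeErdos.exists_lt_norm_of_isClopen (hC.preimage hf) ⟨_, h0⟩ R
  exact hx.not_ge (hR x (hCU hxC))

/-! ### The hyperspace of `spaceP` -/

namespace spaceP

/-- The slices of a compact subset of `spaceP`, together with its projection to the convergent
sequence. The projection records whether the set contains the apex. -/
noncomputable def slices (K : NonemptyCompacts spaceP) :
    (ℕ → Compacts completeErdos) × Compacts convSeq :=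
  (fun n => ⟨slice n ⁻¹' K, (isClosedEmbedding_slice n).isCompact_preimage K.isCompact⟩,
    K.toCompacts.map proj continuous_proj)

theorem continuous_slices : Continuous slices := by
  refine (continuous_pi fun n => ?_).prodMk
    (continuous_proj.compacts_map.comp NonemptyCompacts.continuous_toCompacts)
  refine continuous_iff_continuousAt.2 fun K => tendsto_compacts_nhds (fun U hU hK => ?_)
    fun U hU hK => ?_
  · have hopen : IsOpen (slice n '' Uᶜ)ᶜ := (isClosed_image_slice n hU.isClosed_compl).isOpen_compl
    have hiff : ∀ L : NonemptyCompacts spaceP,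
        slice n ⁻¹' (L : Set spaceP) ⊆ U ↔ (L : Set spaceP) ⊆ (slice n '' Uᶜ)ᶜ := fun L => by
      rw [subset_compl_comm, image_subset_iff, preimage_compl, compl_subset_compl]
    filter_upwards [(NonemptyCompacts.isOpen_subsets_of_isOpen hopen).mem_nhds ((hiff K).1 hK)]
      with L hL using (hiff L).2 hL
  · have hiff : ∀ L : NonemptyCompacts spaceP, (slice n ⁻¹' (L : Set spaceP) ∩ U).Nonempty ↔
        ((L : Set spaceP) ∩ slice n '' U).Nonempty := fun L => by
      rw [inter_comm, inter_comm (L : Set spaceP), image_inter_nonempty_iff]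
    filter_upwards [(NonemptyCompacts.isOpen_inter_nonempty_of_isOpen
      (isOpen_image_slice n hU)).mem_nhds ((hiff K).1 hK)] with L hL using (hiff L).2 hL

/-- The points of `spaceP` except those of norm at most `k` outside the first `N` slices. -/
def headOrLarge (N k : ℕ) : Set spaceP := {z | ∀ n x, z = slice n x → N ≤ n → (k : ℝ) < ‖x.1‖}

theorem slice_mem_headOrLarge {N k n : ℕ} {x : completeErdos} :
    slice n x ∈ headOrLarge N k ↔ (N ≤ n → (k : ℝ) < ‖x.1‖) := by
  refine ⟨fun h => h n x rfl, fun h m y hy => ?_⟩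
  obtain ⟨rfl, rfl⟩ := slice_inj.1 hy
  exact h

theorem apex_mem_headOrLarge (N k : ℕ) : apex ∈ headOrLarge N k := fun n x h =>
  absurd h.symm (slice_ne_apex n x)

theorem isOpen_headOrLarge (N k : ℕ) : IsOpen (headOrLarge N k) := by
  refine isOpen_iff.2 ⟨fun n => ?_, fun _ => ⟨k, fun n _ x hx =>
    slice_mem_headOrLarge.2 fun _ => hx⟩⟩
  have : slice n ⁻¹' headOrLarge N k = {x | N ≤ n → (k : ℝ) < ‖x.1‖} := by
    ext x
    exact slice_mem_headOrLarge
  rw [this]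
  by_cases h : N ≤ n
  · simp only [h, true_imp_iff]
    exact isOpen_lt continuous_const (continuous_norm.comp continuous_subtype_val)
  · simp only [h, false_imp_iff]
    exact isOpen_univ

/-- The sequences of compact sets whose `i`-th term consists of points of norm greater than `k`. -/
def normGT (i k : ℕ) : Set ((ℕ → Compacts completeErdos) × Compacts convSeq) :=
  {y | (y.1 i : Set completeErdos) ⊆ {x | (k : ℝ) < ‖x.1‖}}

theorem isOpen_normGT (i k : ℕ) : IsOpen (normGT i k) :=
  (Compacts.isOpen_subsets_of_isOpen (isOpen_lt continuous_const
    (continuous_norm.comp continuous_subtype_val))).preimage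
      (show Continuous fun y : (ℕ → Compacts completeErdos) × Compacts convSeq => y.1 i by fun_prop)

theorem closure_normGT_subset (i k : ℕ) : closure (normGT i (k + 1)) ⊆ normGT i k := by
  have hcl : IsClosed {x : completeErdos | (k : ℝ) + 1 ≤ ‖x.1‖} :=
    isClosed_le continuous_const (continuous_norm.comp continuous_subtype_val)
  refine (closure_minimal (t := {y | (y.1 i : Set completeErdos) ⊆ {x | (k : ℝ) + 1 ≤ ‖x.1‖}})
    (fun y hy x hx => ?_) ?_).trans fun y hy x hx => ?_
  · have := hy hx
    rw [mem_ofPred_eq] at this ⊢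
    push_cast at this
    exact this.le
  · exact (Compacts.isClosed_subsets_of_isClosed hcl).preimage
      (show Continuous fun y : (ℕ → Compacts completeErdos) × Compacts convSeq => y.1 i by fun_prop)
  · have := hy hx
    rw [mem_ofPred_eq] at this ⊢
    linarith

theorem forall_slices_mem_normGT_iff {K : NonemptyCompacts spaceP} {N k : ℕ} :
    (∀ i ≥ N, slices K ∈ normGT i k) ↔ (K : Set spaceP) ⊆ headOrLarge N k := by
  constructor
  · rintro h z hz n x rfl hn
    exact h n hn hz
  · intro h i hi x hx
    exact slice_mem_headOrLarge.1 (h hx) hi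

/-- The norms of the points of a compact subset of `spaceP` tend to infinity along the slices. -/
theorem exists_forall_slices_mem_normGT (K : NonemptyCompacts spaceP) (k : ℕ) :
    ∃ N, ∀ i ≥ N, slices K ∈ normGT i k := by
  simp only [forall_slices_mem_normGT_iff]
  refine K.isCompact.elim_directed_cover (fun N => headOrLarge N k)
    (fun N => isOpen_headOrLarge N k) (fun z _ => ?_) ?_
  · obtain rfl | ⟨n, x, rfl⟩ := eq_apex_or_slice z
    · exact mem_iUnion.2 ⟨0, apex_mem_headOrLarge 0 k⟩
    · exact mem_iUnion.2 ⟨n + 1, slice_mem_headOrLarge.2 fun h => absurd h (by omega)⟩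
  · exact (monotone_nat_of_le_succ fun N z hz n x h hn => hz n x h (by omega)).directed_le

/-- The Vietoris topology on the compact subsets of `spaceP` is generated by the slices, the
projection, and the uniform growth of the norms along the slices. -/
theorem le_nhds_of_tendsto_slices {K : NonemptyCompacts spaceP}
    {l : Filter (NonemptyCompacts spaceP)} (hl : Filter.Tendsto slices l (𝓝 (slices K)))
    (htail : ∀ N k, (∀ i ≥ N, slices K ∈ normGT i k) → ∀ᶠ L in l, ∀ i ≥ N, slices L ∈ normGT i k) :
    l ≤ 𝓝 K := by
  have hfst : ∀ n, Filter.Tendsto (fun L => (slices L).1 n) l (𝓝 ((slices K).1 n)) := fun n =>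
    (((continuous_apply n).comp continuous_fst).tendsto _).comp hl
  have hsnd : Filter.Tendsto (fun L => (slices L).2) l (𝓝 (slices K).2) :=
    (continuous_snd.tendsto _).comp hl
  suffices h : Filter.Tendsto NonemptyCompacts.toCompacts l (𝓝 K.toCompacts) by
    rw [NonemptyCompacts.isEmbedding_toCompacts.isInducing.nhds_eq_comap]
    exact Filter.tendsto_iff_comap.1 h
  refine tendsto_compacts_nhds (fun U hU hK => ?_) fun U hU hK => ?_
  · have hslice : ∀ N, ∀ᶠ L : NonemptyCompacts spaceP in l, ∀ n ∈ Finset.range N,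
        slice n ⁻¹' (L : Set spaceP) ⊆ slice n ⁻¹' U := fun N =>
      (Filter.eventually_all_finset _).2 fun n _ => (hfst n).eventually
        ((Compacts.isOpen_subsets_of_isOpen (hU.preimage (continuous_slice n))).mem_nhds
          (preimage_mono hK))
    by_cases hp : apex ∈ K
    · obtain ⟨N₁, hN₁⟩ := exists_tail_subset (hU.mem_nhds (hK hp))
      obtain ⟨N₂, hN₂⟩ := exists_forall_slices_mem_normGT K N₁
      filter_upwards [hslice (max N₁ N₂), htail N₂ N₁ hN₂] with L h1 h2 z hz
      obtain rfl | ⟨n, x, rfl⟩ := eq_apex_or_slice z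
      · exact hK hp
      · rcases lt_or_ge n (max N₁ N₂) with hn | hn
        · exact h1 n (Finset.mem_range.2 hn) hz
        · exact hN₁ (slice_mem_tail.2 ⟨(le_max_left _ _).trans hn,
            h2 n ((le_max_right _ _).trans hn) hz⟩)
    · -- A compact set missing the apex meets only finitely many slices.
      obtain ⟨N, hN⟩ : ∃ N, (K : Set spaceP) ⊆ proj ⁻¹' Ioi (convSeq.term N) := by
        refine K.isCompact.elim_directed_cover (fun N => proj ⁻¹' Ioi (convSeq.term N))
          (fun N => isOpen_Ioi.preimage continuous_proj) (fun z hz => ?_) ?_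
        · obtain rfl | ⟨n, x, rfl⟩ := eq_apex_or_slice z
          · exact absurd hz hp
          · exact mem_iUnion.2 ⟨n + 1, convSeq.term_lt_term.2 n.lt_succ_self⟩
        · exact (monotone_nat_of_le_succ fun N z hz =>
            (convSeq.term_lt_term.2 N.lt_succ_self).trans hz).directed_le
      filter_upwards [hslice N, hsnd.eventually ((Compacts.isOpen_subsets_of_isOpen
        (isOpen_Ioi (a := convSeq.term N))).mem_nhds (image_subset_iff.2 hN))] with L h1 h2 z hz
      have hzN : convSeq.term N < proj z := h2 (mem_image_of_mem proj hz)
      obtain rfl | ⟨n, x, rfl⟩ := eq_apex_or_slice z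
      · exact absurd hzN (not_lt.2 (nonneg_of_mem_convSeq (convSeq.term N).2))
      · exact h1 n (Finset.mem_range.2 (convSeq.term_lt_term.1 hzN)) hz
  · obtain ⟨z, hzK, hzU⟩ := hK
    obtain rfl | ⟨n, x, rfl⟩ := eq_apex_or_slice z
    · obtain ⟨N₁, hN₁⟩ := exists_tail_subset (hU.mem_nhds hzU)
      obtain ⟨N₂, hN₂⟩ := exists_forall_slices_mem_normGT K N₁
      have h0 : proj apex < convSeq.term (max N₁ N₂) :=
        show (0 : ℝ) < 1 / (((max N₁ N₂ : ℕ) : ℝ) + 1) by positivity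
      filter_upwards [htail N₂ N₁ hN₂, hsnd.eventually ((Compacts.isOpen_inter_nonempty_of_isOpen
        (isOpen_Iio (a := convSeq.term (max N₁ N₂)))).mem_nhds
          ⟨_, mem_image_of_mem proj hzK, h0⟩)] with L h1 h2
      obtain ⟨_, ⟨w, hwL, rfl⟩, hw⟩ := h2
      refine ⟨w, hwL, ?_⟩
      obtain rfl | ⟨n, x, rfl⟩ := eq_apex_or_slice w
      · exact hzU
      · have hn : max N₁ N₂ < n := convSeq.term_lt_term.1 hw
        exact hN₁ (slice_mem_tail.2 ⟨(le_max_left _ _).trans hn.le,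
          h1 n ((le_max_right _ _).trans hn.le) hwL⟩)
    · filter_upwards [(hfst n).eventually ((Compacts.isOpen_inter_nonempty_of_isOpen
        (hU.preimage (continuous_slice n))).mem_nhds ⟨x, hzK, hzU⟩)] with L hL
      obtain ⟨y, hyL, hyU⟩ := hL
      exact ⟨slice n y, hyL, hyU⟩

/-- The compact subsets of `spaceP` whose sequence of slices has `Ψ` in a set of reals with dense
complement form a zero-dimensional space. -/
theorem isZeroDimensional_setOf_slices_mem {Ψ : (ℕ → Compacts completeErdos) → ℝ}
    (hΨ : IsInducing fun K : ℕ → Compacts completeErdos =>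
      ((fun n => (K n).map completeErdos.coord completeErdos.continuous_coord), Ψ K))
    {A : Set ℝ} (hA : Dense Aᶜ) :
    IsZeroDimensional {K : NonemptyCompacts spaceP | Ψ (slices K).1 ∈ A} := by
  have hΨc : Continuous Ψ := continuous_snd.comp hΨ.continuous
  set Y := {y : (ℕ → Compacts completeErdos) × Compacts convSeq | Ψ y.1 ∈ A}
  -- Sequences with `Ψ` in `A` embed in a product of zero-dimensional spaces.
  have hY : IsZeroDimensional Y := by
    let q : Y → ((ℕ → Compacts (ℕ → convSeq)) × Compacts convSeq) × A := fun y =>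
      ((fun n => (y.1.1 n).map completeErdos.coord completeErdos.continuous_coord, y.1.2),
        ⟨Ψ y.1.1, y.2⟩)
    have hq : IsInducing q := by
      refine .of_comp (g := fun p : ((ℕ → Compacts (ℕ → convSeq)) × Compacts convSeq) × A =>
        ((p.1.1, (p.2 : ℝ)), p.1.2)) ?_ (by fun_prop)
        ((hΨ.prodMap IsInducing.id).comp IsInducing.subtypeVal)
      refine Continuous.prodMk (Continuous.prodMk ?_ ?_) ?_
      · exact (continuous_fst.comp hΨ.continuous).comp (continuous_fst.comp continuous_subtype_val)
      · exact continuous_snd.comp continuous_subtype_val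
      · exact (hΨc.comp (continuous_fst.comp continuous_subtype_val)).subtype_mk _
    exact .of_isInducing hq (((IsZeroDimensional.pi fun n => (IsZeroDimensional.pi fun i =>
      isZeroDimensional_convSeq).compacts).prod isZeroDimensional_convSeq.compacts).prod
        (isZeroDimensional_of_dense_compl hA))
  set X := {K : NonemptyCompacts spaceP | Ψ (slices K).1 ∈ A}
  let g : X → Y := fun K => ⟨slices K.1, K.2⟩
  have hg : Continuous g := (continuous_slices.comp continuous_subtype_val).subtype_mk _
  refine hY.of_uniform_tails hg (O := fun i k => Subtype.val ⁻¹' normGT i k)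
    (fun i k => (isOpen_normGT i k).preimage continuous_subtype_val) (fun i k => ?_) (fun N k => ?_)
    (fun K k => exists_forall_slices_mem_normGT K.1 k) fun K l hl htail => ?_
  · exact (continuous_subtype_val.closure_preimage_subset _).trans
      (preimage_mono (closure_normGT_subset i k))
  · simp only [g, mem_preimage, forall_slices_mem_normGT_iff]
    exact (NonemptyCompacts.isOpen_subsets_of_isOpen (isOpen_headOrLarge N k)).preimage
      continuous_subtype_val
  · rw [nhds_subtype, ← Filter.map_le_iff_le_comap]
    refine le_nhds_of_tendsto_slices ?_ fun N k h => ?_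
    · exact Filter.tendsto_map'_iff.2 ((continuous_subtype_val.tendsto _).comp hl)
    · exact Filter.eventually_map.2 (htail N k h)

theorem hasSmallInductiveDimensionLE_nonemptyCompacts :
    HasSmallInductiveDimensionLE (NonemptyCompacts spaceP) 1 := by
  obtain ⟨Ψ, hΨ⟩ := exists_isInducing_seq_compacts completeErdos.isInducing_coord_height
    completeErdos.continuous_coord completeErdos.injective_coord completeErdos.height_nonneg
    completeErdos.height_le_one completeErdos.exists_isOpen_lt_height
  refine hasSmallInductiveDimensionLE_one_of_compl
    (S := {K | Ψ (slices K).1 ∈ range ((↑) : ℚ → ℝ)})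
    (isZeroDimensional_setOf_slices_mem hΨ dense_irrational) ?_
  exact isZeroDimensional_setOf_slices_mem (A := (range ((↑) : ℚ → ℝ))ᶜ) hΨ
    (by rw [compl_compl]; exact Rat.denseRange_cast)

theorem not_isZeroDimensional : ¬ IsZeroDimensional spaceP := by
  have hball : IsOpen {x : completeErdos | ‖x.1‖ < 1} :=
    isOpen_lt (continuous_norm.comp continuous_subtype_val) continuous_const
  refine completeErdos.not_isZeroDimensional (continuous_slice 0)
    ((isOpen_image_slice 0 hball).mem_nhds (mem_image_of_mem _ ?_)) (R := 1) ?_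
  · simp [completeErdos.zero]
  · rintro x ⟨y, hy, hyx⟩
    obtain rfl := (slice_inj.1 hyx).2
    exact le_of_lt hy

end spaceP

/-- `NonemptyCompacts X` is the space of nonempty compact subsets of `X` with the Vietoris
topology. -/
theorem theorem1p2 :
    SeparableSpace spaceP ∧ MetrizableSpace spaceP ∧
    TotallyDisconnectedSpace spaceP ∧ TotallySeparatedSpace spaceP ∧
    ¬ IsAlmostZeroDimensional spaceP ∧
    smallInductiveDimension spaceP = 1 ∧
    smallInductiveDimension (NonemptyCompacts spaceP) = 1 := by
  have hle := spaceP.hasSmallInductiveDimensionLE_nonemptyCompacts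
  have hnot := spaceP.not_isZeroDimensional
  have hemb : IsInducing ({·} : spaceP → NonemptyCompacts spaceP) :=
    NonemptyCompacts.isEmbedding_singleton.isInducing
  refine ⟨inferInstance, metrizableSpace_of_t3_secondCountable spaceP, inferInstance, inferInstance,
    spaceP.not_isAlmostZeroDimensional, ?_, ?_⟩
  · exact smallInductiveDimension_eq 1 (hasSmallInductiveDimensionLT_of_isInducing hemb hle)
      fun h => hnot (hasSmallInductiveDimensionLT_one_iff.1 h)
  · exact smallInductiveDimension_eq 1 hle fun h => hnot
      (.of_isInducing hemb (hasSmallInductiveDimensionLT_one_iff.1 h))
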